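/- Let $\mathrm{Th}(\mathfrak A)$ denote the complete first-order theory of a structure $\mathfrak A$. A *$\mathbb Z$-group* is a model $(G,+,\le)$ of $\mathrm{Th}(\mathbb Z,+,\le)$, and an *unordered $\mathbb Z$-group* is a model $(G,+,1)$ of $\mathrm{Th}(\mathbb Z,+,1)$. A structure $M$ is *Leibnizian* if for any two distinct elements $a,b\in M$ there is a parameter-free first-order formula $\varphi(x)$ such that $M\models\varphi(a)$ and $M\not\models\varphi(b)$. Let $\hat{\mathbb Z}=\varprojlim_{n>0}\mathbb Z/n\mathbb Z$ be the profinite completion of $\mathbb Z$, with $\mathbb Z\subseteq\hat{\mathbb Z}$ identified with the subgroup generated by $1$. A *$\mathbb Z$-subgroup* of $\hat{\mathbb Z}$ is a subgroup $H$ of $\hat{\mathbb Z}$ that contains $1$ and is pure: for all integers $n>0$ and all $a\in H$, if $a=nb$ for some $b\in\hat{\mathbb Z}$, then $a=nb$ for some $b\in H$. Given a linear order on $\hat{\mathbb Z}/\mathbb Z$ compatible with addition, the *lexicographic order induced by it* on $\hat{\mathbb Z}$ is defined by: $x\le y$ if and only if $g=y-x$ satisfies either $0<g+\mathbb Z$ in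 $\hat{\mathbb Z}/\mathbb Z$, or $g\in\mathbb Z$ and $g\ge 0$ in $\mathbb Z$. **Corollary.** 1. A structure $(M,+,1)$ is a Leibnizian unordered $\mathbb Z$-group if and only if it is isomorphic to $(H,+,1)$ for some $\mathbb Z$-subgroup $H$ of $\hat{\mathbb Z}$. 2. A structure $(M,+,\le)$ is a Leibnizian $\mathbb Z$-group if and only if it is isomorphic to $(H,+,\le)$ for some $\mathbb Z$-subgroup $H$ of $\hat{\mathbb Z}$, where $\le$ is the restriction to $H$ of the lexicographic order on $\hat{\mathbb Z}$ induced by some linear order on $\hat{\mathbb Z}/\mathbb Z$ compatible with addition. 3. For every cardinal $\kappa$ with $\aleph_0\le\kappa\le2^{\aleph_0}$, there exist a non-archimedean Leibnizian $\mathbb Z$-group of cardinality $\kappa$ and a Leibnizian unordered $\mathbb Z$-group of cardinality $\kappa$ that is not isomorphic to $(\mathbb Z,+,1)$. -/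

import Mathlib

open FirstOrder Cardinal

namespace ZGroups

/-! ### Languages and structures -/

/-- Function symbols of the language `{+, ≤}`. -/
inductive OrdFunc : ℕ → Type
  | add : OrdFunc 2

/-- Relation symbols of the language `{+, ≤}`. -/
inductive OrdRel : ℕ → Type
  | le : OrdRel 2

/-- The first-order language `{+, ≤}` of ordered groups. -/
def ordLang : Language where
  Functions := OrdFunc
  Relations := OrdRel

/-- Function symbols of the language `{+, 1}`. -/
inductive UnordFunc : ℕ → Type
  | one : UnordFunc 0
  | add : UnordFunc 2

/-- The first-order language `{+, 1}` of groups with a distinguished element. -/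
def unordLang : Language where
  Functions := UnordFunc
  Relations := fun _ => Empty

/-- `(G, +, ≤)` as a first-order structure. -/
instance ordStructure (G : Type*) [Add G] [LE G] : ordLang.Structure G where
  funMap := fun {_} f => match f with
    | OrdFunc.add => fun v => v 0 + v 1
  RelMap := fun {_} r => match r with
    | OrdRel.le => fun v => v 0 ≤ v 1

/-- `(G, +, 1)` as a first-order structure. -/
instance unordStructure (G : Type*) [Add G] [One G] : unordLang.Structure G where
  funMap := fun {_} f => match f with
    | UnordFunc.one => fun _ => 1
    | UnordFunc.add => fun v => v 0 + v 1
  RelMap := fun {_} r => nomatch r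

/-- A structure is Leibnizian if any two distinct elements are separated by a parameter-free
formula in one free variable. -/
def IsLeibnizian (L : Language) (M : Type*) [L.Structure M] : Prop :=
  ∀ a b : M, a ≠ b →
    ∃ φ : L.Formula Unit, φ.Realize (fun _ => a) ∧ ¬ φ.Realize (fun _ => b)

/-- A (ordered) `ℤ`-group is a model of the complete first-order theory of `(ℤ, +, ≤)`. -/
def IsOrderedZGroup (M : Type*) [ordLang.Structure M] : Prop :=
  M ⊨ ordLang.completeTheory ℤ

/-- An unordered `ℤ`-group is a model of the complete first-order theory of `(ℤ, +, 1)`. -/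
def IsUnorderedZGroup (M : Type*) [unordLang.Structure M] : Prop :=
  M ⊨ unordLang.completeTheory ℤ

/-! ### Pure subgroups -/

/-- `H` is a pure subgroup of `G`: if an element of `H` is divisible by `n > 0` in `G`, then it is
divisible by `n` in `H`. -/
def IsPureSubgroup {G : Type*} [AddCommGroup G] (H : AddSubgroup G) : Prop :=
  ∀ n : ℕ, 0 < n → ∀ a ∈ H, (∃ b : G, a = n • b) → ∃ b ∈ H, a = n • b

/-- `S` is (the underlying set of) a `ℤ`-subgroup of `(G, +, 1)`: a pure subgroup containing `1`. -/
def IsZSubgroup {G : Type*} [AddCommGroup G] [One G] (S : Set G) : Prop :=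
  ∃ H : AddSubgroup G, (H : Set G) = S ∧ 1 ∈ H ∧ IsPureSubgroup H

/-! ### The profinite completion of `ℤ` -/

/-- The inverse limit of the rings `ℤ / n`, `n > 0`, as a subring of their product: the families
`(f n)` with `f n mod m = f m` whenever `m ∣ n`. -/
def zhatSubring : Subring (∀ n : ℕ+, ZMod n) where
  carrier := {f | ∀ (m n : ℕ+) (h : (m : ℕ) ∣ (n : ℕ)), ZMod.castHom h (ZMod m) (f n) = f m}
  mul_mem' := by
    intro f g hf hg m n h
    simp only [Pi.mul_apply, map_mul, hf m n h, hg m n h]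
  one_mem' := by
    intro m n h
    simp only [Pi.one_apply, map_one]
  add_mem' := by
    intro f g hf hg m n h
    simp only [Pi.add_apply, map_add, hf m n h, hg m n h]
  zero_mem' := by
    intro m n h
    simp only [Pi.zero_apply, map_zero]
  neg_mem' := by
    intro f hf m n h
    simp only [Pi.neg_apply, map_neg, hf m n h]

/-- The profinite completion of `ℤ`. -/
def ZHat : Type := zhatSubring

noncomputable instance : CommRing ZHat := inferInstanceAs (CommRing zhatSubring)

/-- The quotient group of the profinite completion of `ℤ` by `ℤ`. -/
abbrev ZHatModZ : Type := ZHat ⧸ AddSubgroup.zmultiples (1 : ZHat)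

/-- Non-negativity in the lexicographic order on `ZHat` induced by the usual order on `ℤ` and a
given order on `ZHat / ℤ`: either the class of `g` is positive, or `g` is a non-negative integer. -/
def LexNonneg [LinearOrder ZHatModZ] (g : ZHat) : Prop :=
  (0 : ZHatModZ) < (g : ZHatModZ) ∨ ∃ n : ℕ, g = (n : ZHat)

/-- The lexicographic order on `ZHat` induced by an order on `ZHat / ℤ`. -/
instance lexLE [LinearOrder ZHatModZ] : LE ZHat where
  le x y := LexNonneg (y - x)

end ZGroups

open ZGroups

universe u

/-! Everything reduces to the algebraic axioms `HasIntDivision` and, for ordered groups,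
`IsPresburger`. Any two models of `IsPresburger` are elementarily equivalent, by a back-and-forth of
finite precision: tuples are compared by the signs of integer linear forms of bounded height and by
residues modulo a fixed number, and `Sim.exists_snoc` adjoins one element at a computable cost in
precision. The argument is uniform in languages whose symbols denote linear forms and their
non-negativity. It also shows that residues and the signs of all `c x + d` determine the type of an
element (`realize_formula_iff`).

Unordered groups need no second argument: `G / ℤ` is torsion-free, hence orderable, and the
lexicographic order makes `G` a model of `IsPresburger`.

A nonzero element divisible by every `n > 0` is infinite up to sign, so it or its negative has the
same type as its double; a Leibnizian group has no such element. Conversely, residue classes are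
definable, so a group without such elements is Leibnizian. This is exactly injectivity of the
residue map to `ZHat`, whose image is pure. In the ordered case `ℤ` is convex in `G`, so the
non-negative cone of `G` has a pointed image in `ZHat / ℤ`, which Zorn's lemma extends to a total
order. Conversely, a pure subgroup containing `1` satisfies `IsPresburger` for the lexicographic
order.

For part 3, factorial expansions give `2 ^ ℵ₀` elements of `ZHat`; the pure hull of `κ` elements,
together with `1` and a non-integer, has cardinality `κ`. -/

namespace ZGroups

/-! ### Axioms for `ℤ`-groups -/

/-- The algebraic axioms of unordered `ℤ`-groups: torsion-freeness, and division with remainder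
by positive integers, where the remainder is a multiple of `1` that is unique modulo the divisor. -/
structure HasIntDivision (G : Type*) [AddCommGroup G] [One G] : Prop where
  eq_zero_of_nsmul : ∀ n : ℕ, 0 < n → ∀ x : G, n • x = 0 → x = 0
  dvd_of_nsmul_eq : ∀ n : ℕ, 0 < n → ∀ (x : G) (k : ℤ), n • x = k • (1 : G) → (n : ℤ) ∣ k
  exists_rem : ∀ n : ℕ, 0 < n → ∀ x : G, ∃ (k : ℤ) (q : G), x = n • q + k • (1 : G)

/-- The axioms of Presburger arithmetic for an ordered abelian group with a distinguished
element `1`. -/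
structure IsPresburger (G : Type*) [AddCommGroup G] [LinearOrder G] [One G] : Prop extends
    HasIntDivision G where
  one_pos : (0 : G) < 1
  one_le : ∀ x : G, 0 < x → 1 ≤ x

theorem HasIntDivision.eq_zero_of_zsmul_one {G : Type*} [AddCommGroup G] [One G]
    (hG : HasIntDivision G) {k : ℤ} (h : k • (1 : G) = 0) : k = 0 := by
  -- Zero is a multiple of everything, so `|k| + 1` divides `k`, which is impossible for `k ≠ 0`.
  have := hG.dvd_of_nsmul_eq (k.natAbs + 1) (by omega) 0 k (by simpa using h.symm)
  by_contra hk
  have := Int.le_of_dvd (by simpa using hk) ((dvd_abs _ _).2 this)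
  simp at this

theorem HasIntDivision.nsmul_left_cancel {G : Type*} [AddCommGroup G] [One G]
    (hG : HasIntDivision G) {n : ℕ} (hn : 0 < n) {x y : G} (h : n • x = n • y) : x = y := by
  have := hG.eq_zero_of_nsmul n hn (x - y) (by rw [nsmul_sub, h, sub_self])
  exact sub_eq_zero.1 this

section Ordered

variable {G : Type*} [AddCommGroup G] [LinearOrder G] [IsOrderedAddMonoid G] [One G]

/-- The order supplies the other two division axioms. If `n x = r 1` with `0 < r < n`, then `x` is
positive, so `x ≥ 1` by discreteness and `n 1 ≤ r 1`, a contradiction. -/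
theorem isPresburger_of_division (h0 : (0 : G) < 1) (h1 : ∀ x : G, 0 < x → 1 ≤ x)
    (hd : ∀ n : ℕ, 0 < n → ∀ x : G, ∃ (k : ℤ) (q : G), x = n • q + k • (1 : G)) :
    IsPresburger G where
  one_pos := h0
  one_le := h1
  exists_rem := hd
  eq_zero_of_nsmul n hn x hx := by
    rcases lt_trichotomy x 0 with h | h | h
    · exact absurd hx (nsmul_neg h hn.ne').ne
    · exact h
    · exact absurd hx (nsmul_pos h hn.ne').ne'
  dvd_of_nsmul_eq n hn x k hx := by
    set r := k % (n : ℤ) with hr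
    have hr0 : 0 ≤ r := Int.emod_nonneg _ (by omega)
    have hrn : r < n := Int.emod_lt_of_pos _ (by omega)
    have hk : k = n * (k / n) + r := (Int.mul_ediv_add_emod k n).symm
    have hy : n • (x - (k / n) • (1 : G)) = r • (1 : G) := by
      rw [nsmul_sub, hx]
      conv_lhs => rw [hk]
      rw [add_zsmul, mul_zsmul, natCast_zsmul]
      rw [← hk]; abel
    rw [Int.dvd_iff_emod_eq_zero]
    by_contra hne
    have hrpos : 0 < r := lt_of_le_of_ne hr0 (Ne.symm hne)
    have hpos : 0 < x - (k / n) • (1 : G) := by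
      by_contra hle
      have h2 := nsmul_nonpos (not_lt.1 hle) n
      rw [hy] at h2
      exact absurd (zsmul_pos h0 hrpos) (not_lt.2 h2)
    have h2 : n • (1 : G) ≤ n • (x - (k / n) • (1 : G)) := nsmul_le_nsmul_right (h1 _ hpos) n
    rw [hy, ← natCast_zsmul, zsmul_le_zsmul_iff_left h0] at h2
    omega

theorem IsPresburger.zsmul_one_nonneg (hG : IsPresburger G) {k : ℤ} :
    0 ≤ k • (1 : G) ↔ 0 ≤ k := by
  rw [← zero_zsmul (1 : G), zsmul_le_zsmul_iff_left hG.one_pos]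

theorem IsPresburger.lt_iff_add_one_le (hG : IsPresburger G) {x y : G} : x < y ↔ x + 1 ≤ y := by
  constructor
  · intro h
    have := hG.one_le (y - x) (sub_pos.2 h)
    rw [le_sub_iff_add_le] at this
    rwa [add_comm]
  · intro h
    exact lt_of_lt_of_le (lt_add_of_pos_right _ hG.one_pos) h

/-- Elements between `0` and a standard integer are standard. -/
theorem exists_nat_of_le (h1 : ∀ x : G, 0 < x → 1 ≤ x) (n : ℕ) {x : G} (h0 : 0 ≤ x)
    (hn : x ≤ n • (1 : G)) : ∃ k : ℕ, x = k • (1 : G) := by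
  induction n generalizing x with
  | zero => exact ⟨0, le_antisymm (by simpa using hn) (by simpa using h0)⟩
  | succ n ih =>
    rcases h0.eq_or_lt with h | h
    · exact ⟨0, by simp [← h]⟩
    · obtain ⟨k, hk⟩ := ih (x := x - 1) (sub_nonneg.2 (h1 x h))
        (by rw [sub_le_iff_le_add]; simpa [succ_nsmul] using hn)
      exact ⟨k + 1, by rw [succ_nsmul, ← hk]; simp⟩

omit [IsOrderedAddMonoid G] in
theorem IsPresburger.exists_rem_range (hG : IsPresburger G) {n : ℕ} (hn : 0 < n) (x : G) :
    ∃ (k : ℕ) (q : G), k < n ∧ x = n • q + k • (1 : G) := by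
  obtain ⟨k, q, h⟩ := hG.exists_rem n hn x
  have hr0 : 0 ≤ k % (n : ℤ) := Int.emod_nonneg _ (by omega)
  have hrn : k % (n : ℤ) < n := Int.emod_lt_of_pos _ (by omega)
  refine ⟨(k % n).toNat, q + (k / n) • (1 : G), by omega, ?_⟩
  rw [h, nsmul_add, ← natCast_zsmul (1 : G) (k % n).toNat, Int.toNat_of_nonneg hr0, add_assoc,
    ← natCast_zsmul ((k / n) • (1 : G)), ← mul_zsmul, ← add_zsmul, Int.mul_ediv_add_emod]

end Ordered

theorem isPresburger_int : IsPresburger ℤ :=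
  isPresburger_of_division (by norm_num) (fun x h => by omega) fun n _ x => ⟨x, 0, by simp⟩

/-! ### Integer linear forms -/

section Lin

variable {ι : Type*} [Fintype ι] {G : Type*} [AddCommGroup G] [One G]

/-- The value at `v` of the integer linear form with coefficients `c` and constant term `d`. -/
def lin (c : ι → ℤ) (d : ℤ) (v : ι → G) : G := ∑ i, c i • v i + d • (1 : G)

theorem lin_add (c c' : ι → ℤ) (d d' : ℤ) (v : ι → G) :
    lin (c + c') (d + d') v = lin c d v + lin c' d' v := by
  simp only [lin, Pi.add_apply, add_zsmul, Finset.sum_add_distrib]; abel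

theorem lin_smul (k : ℤ) (c : ι → ℤ) (d : ℤ) (v : ι → G) :
    lin (k • c) (k * d) v = k • lin c d v := by
  simp only [lin, Pi.smul_apply, smul_eq_mul, mul_zsmul, zsmul_add, Finset.smul_sum]

theorem lin_neg (c : ι → ℤ) (d : ℤ) (v : ι → G) : lin (-c) (-d) v = -lin c d v := by
  have := lin_smul (-1) c d v
  simpa using this

theorem lin_sub (c c' : ι → ℤ) (d d' : ℤ) (v : ι → G) :
    lin (c - c') (d - d') v = lin c d v - lin c' d' v := by
  rw [sub_eq_add_neg, sub_eq_add_neg d, lin_add, lin_neg, sub_eq_add_neg]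

theorem lin_add_const (c : ι → ℤ) (d e : ℤ) (v : ι → G) :
    lin c (d + e) v = lin c d v + e • (1 : G) := by
  simp only [lin, add_zsmul]; abel

theorem lin_single [DecidableEq ι] (i : ι) (v : ι → G) : lin (Pi.single i 1) 0 v = v i := by
  simp [lin, Pi.single_apply, ite_smul]

theorem lin_comp {κ : Type*} [Fintype κ] (a : κ → ℤ) (b : ℤ) (c : κ → ι → ℤ) (d : κ → ℤ)
    (v : ι → G) :
    lin a b (fun k => lin (c k) (d k) v) = lin (∑ k, a k • c k) (∑ k, a k * d k + b) v := by
  simp only [lin, zsmul_add, Finset.sum_add_distrib, add_zsmul, Finset.sum_apply, Pi.smul_apply,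
    smul_eq_mul, mul_zsmul, Finset.sum_smul, Finset.smul_sum]
  rw [Finset.sum_comm]
  abel

theorem lin_snoc {α : Type*} [Fintype α] {n : ℕ} (c : α ⊕ Fin (n + 1) → ℤ) (d : ℤ) (v : α → G)
    (xs : Fin n → G) (x : G) :
    lin c d (Sum.elim v (Fin.snoc xs x : Fin (n + 1) → G)) =
      c (Sum.inr (Fin.last n)) • x +
        lin (Sum.elim (c ∘ Sum.inl) (c ∘ Sum.inr ∘ Fin.castSucc)) d (Sum.elim v xs) := by
  simp only [lin, Fintype.sum_sum_type, Fin.sum_univ_castSucc, Sum.elim_inl, Sum.elim_inr,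
    Fin.snoc_castSucc, Fin.snoc_last, Function.comp_apply]
  abel

/-- If `v i` is congruent to `r i` modulo `m`, then so are the values of linear forms. -/
theorem exists_lin_eq {m : ℕ} {v : ι → G} {r : ι → ℤ}
    (h : ∀ i, ∃ q : G, v i = m • q + r i • (1 : G))
    (c : ι → ℤ) (d : ℤ) : ∃ q : G, lin c d v = m • q + (∑ i, c i * r i + d) • (1 : G) := by
  choose q hq using h
  refine ⟨∑ i, c i • q i, ?_⟩
  simp only [lin, hq, zsmul_add, Finset.sum_add_distrib, add_zsmul, Finset.sum_smul,
    Finset.smul_sum, mul_zsmul]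
  simp only [smul_comm m]
  abel

end Lin

/-! ### Back and forth between models of Presburger arithmetic -/

section FormBounded

variable {ι : Type*}

/-- The coefficients and the constant term of a linear form have absolute value at most `K`. -/
def FormBounded (K : ℕ) (c : ι → ℤ) (d : ℤ) : Prop := (∀ i, |c i| ≤ K) ∧ |d| ≤ K

theorem FormBounded.mono {K K' : ℕ} (hK : K ≤ K') {c : ι → ℤ} {d : ℤ} (h : FormBounded K c d) :
    FormBounded K' c d :=
  ⟨fun i => (h.1 i).trans (by exact_mod_cast hK), h.2.trans (by exact_mod_cast hK)⟩

theorem FormBounded.sub {K K' : ℕ} {c c' : ι → ℤ} {d d' : ℤ} (h : FormBounded K c d)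
    (h' : FormBounded K' c' d') : FormBounded (K + K') (c - c') (d - d') := by
  refine ⟨fun i => ?_, ?_⟩
  · have := abs_sub (c i) (c' i)
    have := h.1 i
    have := h'.1 i
    push_cast
    simp only [Pi.sub_apply]
    linarith
  · have := abs_sub d d'
    have := h.2
    have := h'.2
    push_cast
    linarith

theorem FormBounded.smul {K : ℕ} {c : ι → ℤ} {d : ℤ} (h : FormBounded K c d) (k : ℤ) :
    FormBounded (k.natAbs * K) (k • c) (k * d) := by
  refine ⟨fun i => ?_, ?_⟩
  · simp only [Pi.smul_apply, smul_eq_mul, abs_mul]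
    push_cast
    exact mul_le_mul_of_nonneg_left (h.1 i) (abs_nonneg _)
  · rw [abs_mul]
    push_cast
    exact mul_le_mul_of_nonneg_left h.2 (abs_nonneg _)

theorem FormBounded.const (d : ℤ) : FormBounded d.natAbs (0 : ι → ℤ) d :=
  ⟨fun i => by simp, by simp⟩

theorem finite_formBounded [Fintype ι] (K : ℕ) :
    {p : (ι → ℤ) × ℤ | FormBounded K p.1 p.2}.Finite := by
  classical
  refine ((Set.Finite.pi fun _ : ι => Set.finite_Icc (-(K : ℤ)) K).prod
    (Set.finite_Icc (-(K : ℤ)) K)).subset ?_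
  rintro ⟨c, d⟩ ⟨h1, h2⟩
  exact ⟨fun i _ => abs_le.1 (h1 i), abs_le.1 h2⟩

theorem exists_formBounded [Fintype ι] (c : ι → ℤ) (d : ℤ) :
    ∃ K, FormBounded K c d := by
  refine ⟨∑ i, (c i).natAbs + d.natAbs, fun i => ?_, ?_⟩
  · have := Finset.single_le_sum (f := fun i => (c i).natAbs) (fun _ _ => Nat.zero_le _)
      (Finset.mem_univ i)
    rw [Int.abs_eq_natAbs]
    exact_mod_cast this.trans (Nat.le_add_right _ _)
  · rw [Int.abs_eq_natAbs]
    exact_mod_cast Nat.le_add_left _ _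

end FormBounded

/-! ### Common residues of elements of two groups. -/

section Congr

variable {ι : Type*} [Fintype ι] {G : Type*} [AddCommGroup G] [One G]
  {H : Type*} [AddCommGroup H] [One H]

/-- Two elements have a common integer residue modulo `m`. -/
def Congr (m : ℕ) (x : G) (y : H) :
    Prop :=
  ∃ r : ℤ, (∃ q : G, x = m • q + r • (1 : G)) ∧ ∃ q : H, y = m • q + r • (1 : H)

theorem Congr.symm {m : ℕ} {x : G} {y : H} (h : Congr m x y) : Congr m y x := by
  obtain ⟨r, h1, h2⟩ := h
  exact ⟨r, h2, h1⟩

theorem Congr.of_dvd {m m' : ℕ} (hm : m ∣ m') {x : G} {y : H} (h : Congr m' x y) :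
    Congr m x y := by
  obtain ⟨r, ⟨q, h1⟩, ⟨q', h2⟩⟩ := h
  obtain ⟨t, rfl⟩ := hm
  exact ⟨r, ⟨t • q, by rw [h1, mul_nsmul']⟩, ⟨t • q', by rw [h2, mul_nsmul']⟩⟩

/-- Working modulo `l * m` leaves a residue modulo `m` after division by `l`. If `k` is the residue
of `x` modulo `m`, the form plus `e` is `l k` modulo `l * m` on both sides, so on the other side it
is `l` times an element congruent to `k`. The term with `q` is dropped there. -/
theorem exists_congr_of_dvd (hG : HasIntDivision G) {l m : ℕ} (hl : 0 < l)
    (hm : 0 < m) {v : ι → G} {w : ι → H} (hvw : ∀ i, Congr (l * m) (v i) (w i)) {x q : G}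
    {c : ι → ℤ} {d e : ℤ} (h : l • x = lin c d v + e • (1 : G) + (l * m) • q) :
    ∃ y : H, l • y = lin c d w + e • (1 : H) ∧ Congr m x y := by
  choose r hv hw using hvw
  obtain ⟨q₂, h2⟩ := exists_lin_eq hv c d
  obtain ⟨q₃, h3⟩ := exists_lin_eq hw c d
  obtain ⟨k, q₁, h1⟩ := hG.exists_rem m hm x
  set N := ∑ i, c i * r i + d with hN
  have hdvd : ((l * m : ℕ) : ℤ) ∣ N + e - l * k := by
    refine hG.dvd_of_nsmul_eq _ (by positivity) (q₁ - q₂ - q) _ ?_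
    rw [h2, h1, nsmul_add, ← mul_nsmul'] at h
    rw [nsmul_sub, nsmul_sub, sub_zsmul, add_zsmul, mul_zsmul, natCast_zsmul]
    have : (l * m) • q₁ = (l * m) • q₂ + N • (1 : G) + e • (1 : G) + (l * m) • q
      - l • (k • (1 : G)) := by rw [← h]; abel
    rw [this]; abel
  obtain ⟨t, ht⟩ := hdvd
  refine ⟨m • (q₃ + t • (1 : H)) + k • (1 : H), ?_, k, ⟨q₁, h1⟩, ⟨_, rfl⟩⟩
  have : N = l * k + ((l * m : ℕ) : ℤ) * t - e := by omega
  rw [h3, this, sub_zsmul, add_zsmul, nsmul_add, ← mul_nsmul', nsmul_add, mul_zsmul, mul_zsmul,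
    natCast_zsmul, natCast_zsmul]
  abel

end Congr

/-! ### Finite-precision similarity of tuples and its extension property. -/

section Sim

variable {ι : Type*} [Fintype ι]
variable {G : Type*} [AddCommGroup G] [LinearOrder G] [IsOrderedAddMonoid G] [One G]
variable {H : Type*} [AddCommGroup H] [LinearOrder H] [IsOrderedAddMonoid H] [One H]

/-- Two tuples agree on the signs of all linear forms of height at most `K` and on residues
modulo `m`. -/
structure Sim (K m : ℕ) (v : ι → G) (w : ι → H) : Prop where
  nonneg_iff : ∀ c d, FormBounded K c d → (0 ≤ lin c d v ↔ 0 ≤ lin c d w)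
  congr : ∀ i, Congr m (v i) (w i)

omit [IsOrderedAddMonoid G] [IsOrderedAddMonoid H] in
theorem Sim.symm {K m : ℕ} {v : ι → G} {w : ι → H} (h : Sim K m v w) : Sim K m w v :=
  ⟨fun c d hcd => (h.nonneg_iff c d hcd).symm, fun i => (h.congr i).symm⟩

omit [IsOrderedAddMonoid G] [IsOrderedAddMonoid H] in
theorem Sim.mono {K K' m m' : ℕ} (hK : K ≤ K') (hm : m ∣ m') {v : ι → G} {w : ι → H}
    (h : Sim K' m' v w) : Sim K m v w :=
  ⟨fun c d hcd => h.nonneg_iff c d (hcd.mono hK), fun i => (h.congr i).of_dvd hm⟩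

theorem Sim.le_iff {K K' L m : ℕ} {v : ι → G} {w : ι → H} (h : Sim L m v w) (hL : K + K' ≤ L)
    {c c' : ι → ℤ} {d d' : ℤ} (hc : FormBounded K c d) (hc' : FormBounded K' c' d') :
    lin c' d' v ≤ lin c d v ↔ lin c' d' w ≤ lin c d w := by
  have := h.nonneg_iff _ _ ((hc.sub hc').mono hL)
  rwa [lin_sub, lin_sub, sub_nonneg, sub_nonneg] at this

theorem Sim.eq_iff {K K' L m : ℕ} {v : ι → G} {w : ι → H} (h : Sim L m v w) (hL : K + K' ≤ L)
    {c c' : ι → ℤ} {d d' : ℤ} (hc : FormBounded K c d) (hc' : FormBounded K' c' d') :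
    lin c' d' v = lin c d v ↔ lin c' d' w = lin c d w := by
  rw [le_antisymm_iff, le_antisymm_iff, h.le_iff hL hc hc',
    h.le_iff (by omega : K' + K ≤ L) hc' hc]

/-- The cut that `l • x` makes in the linear forms of height at most `B` can be realized by a
multiple of `l` on the other side. -/
theorem Sim.exists_cut (hG : IsPresburger G) (hH : IsPresburger H) {l m B : ℕ} (hl : 0 < l)
    (hm : 0 < m) {v : ι → G} {w : ι → H} (h : Sim (2 * B + l * m) (l * m) v w) (x : G) :
    ∃ y : H, Congr m x y ∧
      ∀ c d, FormBounded B c d → (lin c d v ≤ l • x ↔ lin c d w ≤ l • y) := by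
  have hlm : 0 < l * m := by positivity
  have fin := finite_formBounded (ι := ι) B
  by_cases hne : ∃ c d, FormBounded B c d ∧ lin c d v ≤ l • x
  · obtain ⟨c₀, d₀, hb₀, hle₀⟩ := hne
    -- Take the largest form below `l • x` and let `s < l * m` be the remainder of the distance.
    -- Then `y` is defined by `l • y = form + s`. Comparing `form + s` with another form needs
    -- height `2 * B + s` only.
    obtain ⟨⟨c, d⟩, ⟨hb, hle⟩, hmax⟩ := Set.exists_max_image
      {p : (ι → ℤ) × ℤ | FormBounded B p.1 p.2 ∧ lin p.1 p.2 v ≤ l • x}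
      (fun p => lin p.1 p.2 v) (fin.subset fun p hp => hp.1) ⟨(c₀, d₀), hb₀, hle₀⟩
    obtain ⟨s, q, hs, hsq⟩ := hG.exists_rem_range hlm (l • x - lin c d v)
    -- A negative quotient would make the distance at most `s - l * m < 0`.
    have hq : 0 ≤ q := by
      by_contra hq
      have h1 : q ≤ -1 := by
        have := hG.one_le (-q) (by simpa using hq)
        exact le_neg_of_le_neg this
      have h2 : (l * m) • q ≤ (l * m) • (-1 : G) := nsmul_le_nsmul_right h1 _
      have h3 : (0 : G) ≤ (l * m) • (-1 : G) + s • (1 : G) := by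
        refine le_trans (sub_nonneg.2 hle) ?_
        rw [hsq]
        exact add_le_add_left h2 _
      rw [smul_neg, neg_add_eq_sub, sub_nonneg] at h3
      rw [nsmul_le_nsmul_iff_left hG.one_pos] at h3
      omega
    obtain ⟨y, hy, hxy⟩ := exists_congr_of_dvd (c := c) (d := d) (e := s)
      hG.toHasIntDivision hl hm h.congr (x := x) (q := q)
      (by rw [natCast_zsmul, add_assoc, add_comm (s • (1 : G)), ← hsq]; abel)
    refine ⟨y, hxy, fun c' d' hb' => ?_⟩
    rw [hy]
    constructor
    · intro hle'
      refine (((h.le_iff (by omega) hb hb').1 (hmax (c', d') ⟨hb', hle'⟩)).trans ?_)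
      rw [natCast_zsmul]
      exact le_add_of_nonneg_right (nsmul_nonneg hH.one_pos.le _)
    · intro hle'
      have hbs : FormBounded (B + s) c (d + s) := by
        have := hb.sub (FormBounded.const (-(s : ℤ)))
        simpa using this
      rw [← lin_add_const, ← h.le_iff (by omega) hbs hb', lin_add_const] at hle'
      refine hle'.trans ?_
      have : l • x = lin c d v + (l * m) • q + s • (1 : G) := by
        rw [add_assoc, ← hsq]; abel
      rw [this, natCast_zsmul]
      exact add_le_add_left (le_add_of_nonneg_right (nsmul_nonneg hq _)) _
  · push Not at hne
    -- When `l • x` is below all forms, `l • y` is placed `1 + s` below the least one, with `s`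
    -- chosen to give the right residue.
    obtain ⟨⟨c, d⟩, hb, hmin⟩ := Set.exists_min_image
      {p : (ι → ℤ) × ℤ | FormBounded B p.1 p.2}
      (fun p => lin p.1 p.2 v) fin ⟨(0, 0), by simp [FormBounded]⟩
    obtain ⟨s, q, hs, hsq⟩ := hG.exists_rem_range hlm (lin c d v - 1 - l • x)
    obtain ⟨y, hy, hxy⟩ := exists_congr_of_dvd (c := c) (d := d) (e := -1 - s)
      hG.toHasIntDivision hl hm h.congr (x := x) (q := -q) (by
        have : l • x = lin c d v - 1 - ((l * m) • q + s • (1 : G)) := by rw [← hsq]; abel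
        rw [this, sub_zsmul, smul_neg, natCast_zsmul, neg_one_zsmul]; abel)
    refine ⟨y, hxy, fun c' d' hb' => iff_of_false (not_le.2 (hne c' d' hb')) (not_le.2 ?_)⟩
    refine lt_of_lt_of_le ?_ ((h.le_iff (by omega) hb' hb).1 (hmin (c', d') hb'))
    rw [hy]
    refine add_lt_of_neg_right _ ?_
    rw [← neg_neg (-1 - (s : ℤ)), neg_zsmul, neg_lt_zero]
    exact zsmul_pos hH.one_pos (by omega)

theorem nonneg_add_iff_of_pos {G : Type*} [AddCommGroup G] [LinearOrder G] [IsOrderedAddMonoid G]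
    {t : ℕ} (ht : 0 < t) (k : ℤ) (x a : G) :
    0 ≤ k • x + a ↔ -(t : ℤ) • a ≤ ((t : ℤ) * k) • x := by
  rw [← nsmul_nonneg_iff ht.ne', nsmul_add, ← neg_le_iff_add_nonneg, neg_zsmul, mul_zsmul,
    natCast_zsmul, natCast_zsmul]

/-- Every similarity of tuples extends to one more element, at the cost of precision. -/
theorem Sim.exists_extension (hG : IsPresburger G) (hH : IsPresburger H) {K m : ℕ} (hm : 0 < m)
    {v : ι → G} {w : ι → H}
    (h : Sim (2 * (K.factorial * (K + 1)) + K.factorial * m) (K.factorial * m) v w) (x : G) :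
    ∃ y : H, Congr m x y ∧ ∀ k c d, |k| ≤ (K : ℤ) → FormBounded K c d →
      (0 ≤ k • x + lin c d v ↔ 0 ≤ k • y + lin c d w) := by
  have hl := K.factorial_pos
  -- Every nonzero `|k| ≤ K` divides `K!`. Scaling `k • x + form` by `t = K! / |k|` turns its sign
  -- into a comparison of `K! • x` with a form of height at most `K! * (K + 1)`, so a single cut of
  -- `K! • x` decides all of them.
  obtain ⟨y, hxy, hy⟩ := h.exists_cut hG hH hl hm x
  refine ⟨y, hxy, fun k c d hk hcd => ?_⟩
  rcases lt_trichotomy k 0 with hk0 | rfl | hk0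
  · obtain ⟨j, rfl⟩ : ∃ j : ℕ, k = -j := ⟨k.natAbs, by omega⟩
    obtain ⟨t, ht⟩ := Nat.dvd_factorial (n := K) (show 0 < j by omega) (by simpa using hk)
    have ht0 : 0 < t := by
      rcases Nat.eq_zero_or_pos t with rfl | h'
      · omega
      · exact h'
    have htK : t ≤ K.factorial := by rw [ht]; exact Nat.le_mul_of_pos_left _ (by omega)
    -- For negative `k` an upper bound `K! • x ≤ t • form` is needed. By discreteness it is the
    -- negation of `t • form + 1 ≤ K! • x`, whence the constant `t * d + 1`.
    have hb : FormBounded (K.factorial * (K + 1)) ((t : ℤ) • c) (t * d + 1) := by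
      have h1 := (hcd.smul t).sub (FormBounded.const (-1))
      rw [sub_zero, sub_neg_eq_add] at h1
      refine h1.mono ?_
      simp only [Int.natAbs_natCast, Int.natAbs_neg, Int.natAbs_one]
      nlinarith
    have key := hy _ _ hb
    rw [lin_add_const, lin_add_const, lin_smul, lin_smul, one_zsmul, one_zsmul,
      ← hG.lt_iff_add_one_le, ← hH.lt_iff_add_one_le, ← not_le, ← not_le, not_iff_not, ht,
      ← natCast_zsmul, ← natCast_zsmul] at key
    rw [nonneg_add_iff_of_pos ht0, nonneg_add_iff_of_pos ht0]
    simp only [neg_zsmul, mul_neg, neg_le_neg_iff]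
    rw [mul_comm (t : ℤ)]
    exact_mod_cast key
  · simpa using h.nonneg_iff c d (hcd.mono (by nlinarith))
  · obtain ⟨j, rfl⟩ : ∃ j : ℕ, k = j := ⟨k.natAbs, by omega⟩
    obtain ⟨t, ht⟩ := Nat.dvd_factorial (n := K) (show 0 < j by omega) (by simpa using hk)
    have ht0 : 0 < t := by
      rcases Nat.eq_zero_or_pos t with rfl | h'
      · omega
      · exact h'
    have htK : t ≤ K.factorial := by rw [ht]; exact Nat.le_mul_of_pos_left _ (by omega)
    have hb : FormBounded (K.factorial * (K + 1)) (-(t : ℤ) • c) (-(t : ℤ) * d) := by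
      refine (hcd.smul (-(t : ℤ))).mono ?_
      simp only [Int.natAbs_natCast, Int.natAbs_neg]
      nlinarith
    have key := hy _ _ hb
    rw [lin_smul, lin_smul, ht, ← natCast_zsmul, ← natCast_zsmul] at key
    rw [nonneg_add_iff_of_pos ht0, nonneg_add_iff_of_pos ht0, mul_comm (t : ℤ)]
    exact_mod_cast key

theorem Sim.exists_snoc {α : Type*} [Fintype α] {n : ℕ} (hG : IsPresburger G) (hH : IsPresburger H)
    {K m : ℕ} (hm : 0 < m) {v : α → G} {w : α → H} {xs : Fin n → G} {ys : Fin n → H}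
    (h : Sim (2 * (K.factorial * (K + 1)) + K.factorial * m) (K.factorial * m)
      (Sum.elim v xs) (Sum.elim w ys)) (x : G) :
    ∃ y : H, Sim K m (Sum.elim v (Fin.snoc xs x : Fin (n + 1) → G))
      (Sum.elim w (Fin.snoc ys y : Fin (n + 1) → H)) := by
  obtain ⟨y, hxy, hy⟩ := h.exists_extension hG hH hm x
  refine ⟨y, fun c d hcd => ?_, ?_⟩
  · rw [lin_snoc, lin_snoc]
    refine hy _ _ _ (hcd.1 _) ⟨?_, hcd.2⟩
    rintro (i | i)
    exacts [hcd.1 _, hcd.1 _]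
  · rintro (i | i)
    · exact (h.congr (Sum.inl i)).of_dvd (Dvd.intro_left _ rfl)
    · refine Fin.lastCases ?_ (fun i => ?_) i
      · simpa using hxy
      · simpa using (h.congr (Sum.inr i)).of_dvd (Dvd.intro_left _ rfl)

end Sim

/-! ### Elementary equivalence -/

/-- An interpretation of the function symbols of `L` as integer linear forms, and of its relation
symbols as non-negativity of integer linear forms. -/
structure LinearInterpretation (L : Language) where
  /-- The linear form of a function symbol. -/
  fn : ∀ {n : ℕ}, L.Functions n → (Fin n → ℤ) × ℤ
  /-- The linear form whose non-negativity a relation symbol expresses. -/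
  rel : ∀ {n : ℕ}, L.Relations n → (Fin n → ℤ) × ℤ

/-- The structure on `G` is given by the interpretation `I`. -/
structure LinearInterpretation.Models {L : Language} (I : LinearInterpretation L) (G : Type*)
    [AddCommGroup G] [One G] [LE G] [L.Structure G] : Prop where
  funMap_eq : ∀ {n : ℕ} (f : L.Functions n) (v : Fin n → G),
    Language.Structure.funMap f v = lin (I.fn f).1 (I.fn f).2 v
  relMap_iff : ∀ {n : ℕ} (r : L.Relations n) (v : Fin n → G),
    Language.Structure.RelMap r v ↔ 0 ≤ lin (I.rel r).1 (I.rel r).2 v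

section Transfer

variable {L : Language} (I : LinearInterpretation L)
variable {G : Type*} [AddCommGroup G] [LinearOrder G] [IsOrderedAddMonoid G] [One G] [L.Structure G]
variable {H : Type*} [AddCommGroup H] [LinearOrder H] [IsOrderedAddMonoid H] [One H] [L.Structure H]

/-- The linear form of a term. -/
noncomputable def LinearInterpretation.term {ι : Type*} [DecidableEq ι] :
    L.Term ι → (ι → ℤ) × ℤ
  | .var i => (Pi.single i 1, 0)
  | .func f ts => (∑ k, (I.fn f).1 k • (term (ts k)).1,
      ∑ k, (I.fn f).1 k * (term (ts k)).2 + (I.fn f).2)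

variable {I}

omit [IsOrderedAddMonoid G] in
theorem LinearInterpretation.Models.realize_term (hI : I.Models G) {ι : Type*} [Fintype ι]
    [DecidableEq ι] (t : L.Term ι) (v : ι → G) :
    t.realize v = lin (I.term t).1 (I.term t).2 v := by
  induction t with
  | var i => simp [LinearInterpretation.term, lin_single]
  | func f ts ih =>
    rw [Language.Term.realize_func, hI.funMap_eq, LinearInterpretation.term, ← lin_comp]
    simp only [ih]

/-- Every formula is preserved by similarity of tuples of sufficient precision. -/
theorem exists_sim_realize_iff (hG : IsPresburger G) (hH : IsPresburger H) (hIG : I.Models G)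
    (hIH : I.Models H) {α : Type*} [Fintype α] {n : ℕ} (φ : L.BoundedFormula α n) :
    ∃ K m : ℕ, 0 < m ∧ ∀ (v : α → G) (w : α → H) (xs : Fin n → G) (ys : Fin n → H),
      Sim K m (Sum.elim v xs) (Sum.elim w ys) → (φ.Realize v xs ↔ φ.Realize w ys) := by
  classical
  induction φ with
  | falsum => exact ⟨0, 1, one_pos, fun _ _ _ _ _ => Iff.rfl⟩
  | equal t₁ t₂ =>
    obtain ⟨K₁, h1⟩ := exists_formBounded (I.term t₁).1 (I.term t₁).2
    obtain ⟨K₂, h2⟩ := exists_formBounded (I.term t₂).1 (I.term t₂).2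
    refine ⟨K₂ + K₁, 1, one_pos, fun v w xs ys h => ?_⟩
    simp only [Language.BoundedFormula.Realize, hIG.realize_term, hIH.realize_term]
    exact h.eq_iff le_rfl h2 h1
  | rel R ts =>
    obtain ⟨K, hK⟩ := exists_formBounded (∑ k, (I.rel R).1 k • (I.term (ts k)).1)
      (∑ k, (I.rel R).1 k * (I.term (ts k)).2 + (I.rel R).2)
    refine ⟨K, 1, one_pos, fun v w xs ys h => ?_⟩
    simp only [Language.BoundedFormula.Realize, hIG.realize_term, hIH.realize_term,
      hIG.relMap_iff, hIH.relMap_iff, lin_comp]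
    exact h.nonneg_iff _ _ hK
  | imp φ ψ ih₁ ih₂ =>
    obtain ⟨K₁, m₁, hm₁, h1⟩ := ih₁
    obtain ⟨K₂, m₂, hm₂, h2⟩ := ih₂
    refine ⟨max K₁ K₂, m₁ * m₂, Nat.mul_pos hm₁ hm₂, fun v w xs ys h => ?_⟩
    simp only [Language.BoundedFormula.realize_imp]
    rw [h1 v w xs ys (h.mono (le_max_left _ _) (Dvd.intro _ rfl)),
      h2 v w xs ys (h.mono (le_max_right _ _) (Dvd.intro_left _ rfl))]
  | all φ ih =>
    obtain ⟨K, m, hm, ih⟩ := ih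
    -- This is the price of one quantifier; similarity is symmetric, so witnesses can be moved both
    -- ways.
    refine ⟨2 * (K.factorial * (K + 1)) + K.factorial * m, K.factorial * m,
      Nat.mul_pos K.factorial_pos hm, fun v w xs ys h => ?_⟩
    simp only [Language.BoundedFormula.realize_all]
    constructor
    · intro hφ y
      obtain ⟨x, hx⟩ := h.symm.exists_snoc hH hG hm y
      exact (ih _ _ _ _ hx.symm).1 (hφ x)
    · intro hφ x
      obtain ⟨y, hy⟩ := h.exists_snoc hG hH hm x
      exact (ih _ _ _ _ hy).2 (hφ y)

/-- Two elements with the same signs of integer linear forms and the same residues have the same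
type. -/
theorem realize_formula_iff (hG : IsPresburger G) (hI : I.Models G) {a b : G}
    (h0 : ∀ c d : ℤ, 0 ≤ c • a + d • (1 : G) ↔ 0 ≤ c • b + d • (1 : G))
    (h1 : ∀ m : ℕ, 0 < m → Congr m a b) (φ : L.Formula Unit) :
    φ.Realize (fun _ => a) ↔ φ.Realize (fun _ => b) := by
  obtain ⟨K, m, hm, h⟩ := exists_sim_realize_iff hG hG hI hI φ
  refine h _ _ _ _ ⟨fun c d _ => ?_, ?_⟩
  · simpa [lin] using h0 (c (Sum.inl ())) d
  · rintro (i | i)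
    · exact h1 m hm
    · exact i.elim0

/-- Models of Presburger arithmetic are elementarily equivalent. -/
theorem elementarilyEquivalent (hG : IsPresburger G) (hH : IsPresburger H) (hIG : I.Models G)
    (hIH : I.Models H) : L.ElementarilyEquivalent G H := by
  rw [Language.elementarilyEquivalent_iff]
  intro φ
  obtain ⟨K, m, hm, h⟩ := exists_sim_realize_iff hG hH hIG hIH φ
  refine h _ _ _ _ ⟨fun c d _ => ?_, ?_⟩
  · simp [lin, hG.zsmul_one_nonneg, hH.zsmul_one_nonneg]
  · rintro (i | i)
    · exact i.elim
    · exact i.elim0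

end Transfer

/-! ### Orders on torsion-free abelian groups -/

section Cone

variable {A : Type*} [AddCommGroup A]

/-- A submonoid is pointed if it contains no nonzero element together with its negative. -/
def IsPointed (C : AddSubmonoid A) : Prop := ∀ x ∈ C, -x ∈ C → x = 0

/-- By maximality `D + ℕ x` is not pointed, so it contains some `y = d + n x ≠ 0` with `-y = d' + n'
x`; adding gives `-(n + n') x = d + d'`. Since `D` is pointed, `n + n'` is positive. -/
theorem exists_neg_nsmul_mem_of_maximal {D : AddSubmonoid A} (hD : Maximal IsPointed D) {x : A}
    (hx : x ∉ D) : ∃ N : ℕ, 0 < N ∧ -(N • x) ∈ D := by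
  have hlt : ¬ D ⊔ AddSubmonoid.multiples x ≤ D := fun h =>
    hx (h (le_sup_right (a := D) (AddSubmonoid.mem_multiples x)))
  have hnp : ¬ IsPointed (D ⊔ AddSubmonoid.multiples x) := fun h =>
    hlt (hD.2 h le_sup_left)
  simp only [IsPointed, not_forall] at hnp
  obtain ⟨y, hy, hy', hy0⟩ := hnp
  obtain ⟨d, hd, _, ⟨n, rfl⟩, h1⟩ := AddSubmonoid.mem_sup.1 hy
  obtain ⟨d', hd', _, ⟨n', rfl⟩, h2⟩ := AddSubmonoid.mem_sup.1 hy'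
  simp only at h1 h2
  have hsum : -((n + n') • x) = d + d' := by
    have h3 : (d + n • x) + (d' + n' • x) = 0 := by rw [h1, h2, add_neg_cancel]
    rw [add_nsmul, neg_eq_iff_add_eq_zero, ← h3]; abel
  rcases Nat.eq_zero_or_pos (n + n') with h | h
  · exfalso
    obtain ⟨rfl, rfl⟩ : n = 0 ∧ n' = 0 := by omega
    rw [zero_nsmul, add_zero] at h1 h2
    exact hy0 (h1 ▸ hD.1 d hd (by rw [h1, ← h2]; exact hd'))
  · exact ⟨_, h, hsum ▸ D.add_mem hd hd'⟩

/-- Every pointed cone in a torsion-free abelian group extends to a total one. -/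
theorem exists_total_cone (htf : ∀ n : ℕ, 0 < n → ∀ x : A, n • x = 0 → x = 0)
    (C : AddSubmonoid A) (hC : IsPointed C) :
    ∃ D : AddSubmonoid A, C ≤ D ∧ IsPointed D ∧ ∀ x, x ∈ D ∨ -x ∈ D := by
  obtain ⟨D, hCD, hD⟩ := zorn_le_nonempty₀ {C : AddSubmonoid A | IsPointed C} (by
    intro c hc hchain y hy
    have hne : c.Nonempty := ⟨y, hy⟩
    have hdir := hchain.directedOn
    refine ⟨sSup c, fun x hx hx' => ?_, fun z hz => le_sSup hz⟩
    obtain ⟨E₁, hE₁, h1⟩ := (AddSubmonoid.mem_sSup_of_directedOn hne hdir).1 hx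
    obtain ⟨E₂, hE₂, h2⟩ := (AddSubmonoid.mem_sSup_of_directedOn hne hdir).1 hx'
    obtain ⟨E, hE, hl1, hl2⟩ := hdir E₁ hE₁ E₂ hE₂
    exact hc hE x (hl1 h1) (hl2 h2)) C hC
  refine ⟨D, hCD, hD.1, fun x => ?_⟩
  by_contra! hx
  obtain ⟨N, hN, h1⟩ := exists_neg_nsmul_mem_of_maximal hD hx.1
  obtain ⟨N', hN', h2⟩ := exists_neg_nsmul_mem_of_maximal hD hx.2
  rw [smul_neg, neg_neg] at h2
  -- Both `N' • x` and `-(N • x)` lie in `D`, so `(N * N') • x` and its negative do.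
  have h3 : (N * N') • x = 0 := by
    refine hD.1 _ ?_ ?_
    · rw [mul_nsmul']; exact D.nsmul_mem h2 N
    · rw [mul_nsmul, ← smul_neg]; exact D.nsmul_mem h1 N'
  have := htf _ (Nat.mul_pos hN hN') x h3
  exact hx.1 (this ▸ D.zero_mem)

theorem exists_linearOrder_of_cone (D : AddSubmonoid A) (hD : IsPointed D)
    (ht : ∀ x, x ∈ D ∨ -x ∈ D) :
    ∃ (_ : LinearOrder A) (_ : IsOrderedAddMonoid A), ∀ x y : A, x ≤ y ↔ y - x ∈ D := by
  classical
  let C : AddGroupCone A := { D with eq_zero_of_mem_of_neg_mem' := fun {a} h h' => hD a h h' }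
  have : HasMemOrNegMem C := ⟨ht⟩
  exact ⟨LinearOrder.mkOfAddGroupCone C, IsOrderedAddMonoid.mkOfCone C, fun x y => Iff.rfl⟩

theorem exists_linearOrder_extending (htf : ∀ n : ℕ, 0 < n → ∀ x : A, n • x = 0 → x = 0)
    (C : AddSubmonoid A) (hC : IsPointed C) :
    ∃ (_ : LinearOrder A) (_ : IsOrderedAddMonoid A), ∀ x ∈ C, 0 ≤ x := by
  obtain ⟨D, hCD, hD, ht⟩ := exists_total_cone htf C hC
  obtain ⟨lo, ho, h⟩ := exists_linearOrder_of_cone D hD ht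
  exact ⟨lo, ho, fun x hx => (h 0 x).2 (by simpa using hCD hx)⟩

theorem exists_linearOrder (htf : ∀ n : ℕ, 0 < n → ∀ x : A, n • x = 0 → x = 0) :
    ∃ (_ : LinearOrder A), IsOrderedAddMonoid A := by
  obtain ⟨lo, ho, -⟩ := exists_linearOrder_extending htf ⊥ fun x hx _ => by simpa using hx
  exact ⟨lo, ho⟩

end Cone

/-! ### Lexicographic orders on groups with division. -/

section Lex

variable {G : Type*} [AddCommGroup G] [One G]

/-- If `n x = k 1`, then `n ∣ k`, and torsion-freeness of `G` gives `x = (k / n) 1`. This is what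
makes the quotient orderable. -/
theorem HasIntDivision.torsionFree_quotient (hG : HasIntDivision G) (n : ℕ) (hn : 0 < n)
    (x : G ⧸ AddSubgroup.zmultiples (1 : G)) (hx : n • x = 0) : x = 0 := by
  induction x using QuotientAddGroup.induction_on with
  | H x =>
    rw [← QuotientAddGroup.mk_nsmul, QuotientAddGroup.eq_zero_iff,
      AddSubgroup.mem_zmultiples_iff] at hx
    obtain ⟨k, hk⟩ := hx
    obtain ⟨l, rfl⟩ := hG.dvd_of_nsmul_eq n hn x k hk.symm
    rw [QuotientAddGroup.eq_zero_iff, AddSubgroup.mem_zmultiples_iff]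
    refine ⟨l, hG.nsmul_left_cancel hn ?_⟩
    rw [← hk, mul_zsmul, natCast_zsmul]

/-- The lexicographic order on a group with division, induced by an order on the quotient
by the multiples of `1`. -/
theorem HasIntDivision.exists_lexOrder (hG : HasIntDivision G) {Q : Type*} [AddCommGroup Q]
    [LinearOrder Q] [IsOrderedAddMonoid Q] (f : G →+ Q)
    (hf : ∀ x, f x = 0 ↔ ∃ k : ℤ, x = k • (1 : G)) :
    ∃ (_ : LinearOrder G) (_ : IsOrderedAddMonoid G), IsPresburger G ∧
      ∀ x y : G, x ≤ y ↔ 0 < f (y - x) ∨ ∃ n : ℕ, y - x = n • (1 : G) := by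
  have hf1 : ∀ n : ℕ, f (n • (1 : G)) = 0 := fun n => (hf _).2 ⟨n, by simp⟩
  -- The kernel of `f` is `ℤ` but `f` need not be onto, so the same cone serves for `G → G / ℤ` and
  -- for the map of a subgroup of `ZHat` to `ZHat / ℤ`.
  let D : AddSubmonoid G :=
    { carrier := {x | 0 < f x ∨ ∃ n : ℕ, x = n • (1 : G)}
      zero_mem' := Or.inr ⟨0, by simp⟩
      add_mem' := by
        rintro x y (hx | ⟨n, rfl⟩) (hy | ⟨m, rfl⟩)
        · exact Or.inl (by rw [map_add]; exact add_pos hx hy)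
        · exact Or.inl (by rwa [map_add, hf1, add_zero])
        · exact Or.inl (by rwa [map_add, hf1, zero_add])
        · exact Or.inr ⟨n + m, by rw [add_nsmul]⟩ }
  have hmem : ∀ x, x ∈ D ↔ 0 < f x ∨ ∃ n : ℕ, x = n • (1 : G) := fun x => Iff.rfl
  have hD : IsPointed D := by
    rintro x (hx | ⟨n, rfl⟩) (hy | ⟨m, hm⟩)
    · rw [map_neg, neg_pos] at hy
      exact absurd hx hy.not_gt
    · rw [neg_eq_iff_eq_neg] at hm
      rw [hm, map_neg, hf1] at hx
      simp at hx
    · rw [map_neg, hf1] at hy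
      simp at hy
    · rw [neg_eq_iff_add_eq_zero, ← add_nsmul, ← natCast_zsmul] at hm
      have := hG.eq_zero_of_zsmul_one hm
      obtain rfl : n = 0 := by omega
      simp
  have ht : ∀ x, x ∈ D ∨ -x ∈ D := by
    intro x
    rcases lt_trichotomy (f x) 0 with h | h | h
    · exact Or.inr (Or.inl (by simpa using h))
    · obtain ⟨k, rfl⟩ := (hf x).1 h
      rcases le_total 0 k with hk | hk
      · exact Or.inl (Or.inr ⟨k.toNat, by rw [← natCast_zsmul, Int.toNat_of_nonneg hk]⟩)
      · exact Or.inr (Or.inr ⟨(-k).toNat, by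
          rw [← natCast_zsmul, Int.toNat_of_nonneg (by omega), neg_zsmul]⟩)
    · exact Or.inl (Or.inl h)
  obtain ⟨lo, ho, hle⟩ := exists_linearOrder_of_cone D hD ht
  have h10 : (1 : G) ≠ 0 := fun h => by
    have := hG.eq_zero_of_zsmul_one (k := 1) (by rw [one_zsmul, h])
    omega
  refine ⟨lo, ho, isPresburger_of_division ?_ ?_ hG.exists_rem, fun x y => (hle x y).trans (hmem _)⟩
  · refine lt_of_le_of_ne ((hle _ _).2 ?_) h10.symm
    exact Or.inr ⟨1, by simp⟩
  · intro x hx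
    rw [hle]
    have h1 := (hle _ _).1 hx.le
    rw [sub_zero] at h1
    rcases h1 with h | ⟨n, rfl⟩
    · left
      rw [map_sub, ← one_nsmul (1 : G), hf1, sub_zero]
      exact h
    · right
      have : n ≠ 0 := by rintro rfl; simp at hx
      obtain ⟨m, rfl⟩ := Nat.exists_eq_succ_of_ne_zero this
      exact ⟨m, by rw [succ_nsmul]; simp⟩

/-- The order is auxiliary: it gives access to the ordered back-and-forth and is then forgotten by
the language `{+, 1}`. -/
theorem HasIntDivision.exists_isPresburger (hG : HasIntDivision G) :
    ∃ (_ : LinearOrder G) (_ : IsOrderedAddMonoid G), IsPresburger G := by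
  obtain ⟨lo, ho⟩ := exists_linearOrder hG.torsionFree_quotient
  obtain ⟨lo', ho', h, -⟩ := hG.exists_lexOrder
    (QuotientAddGroup.mk' (AddSubgroup.zmultiples (1 : G))) fun x => by
      rw [QuotientAddGroup.mk'_apply, QuotientAddGroup.eq_zero_iff,
        AddSubgroup.mem_zmultiples_iff]
      exact ⟨fun ⟨k, h⟩ => ⟨k, h.symm⟩, fun ⟨k, h⟩ => ⟨k, h.symm⟩⟩
  exact ⟨lo', ho', h⟩

end Lex

/-! ### The languages `{+, ≤}` and `{+, 1}` -/

/-- The symbols of `{+, ≤}` as linear forms. -/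
def ordInterpretation : LinearInterpretation ordLang where
  fn := fun {_} f => match f with
    | OrdFunc.add => (fun _ => 1, 0)
  rel := fun {_} r => match r with
    | OrdRel.le => (![-1, 1], 0)

/-- The symbols of `{+, 1}` as linear forms. -/
def unordInterpretation : LinearInterpretation unordLang where
  fn := fun {_} f => match f with
    | UnordFunc.one => (fun _ => 0, 1)
    | UnordFunc.add => (fun _ => 1, 0)
  rel := fun {_} r => nomatch r

section Models

variable {G : Type*} [AddCommGroup G] [LinearOrder G] [IsOrderedAddMonoid G] [One G]

theorem ordInterpretation_models : ordInterpretation.Models G where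
  funMap_eq f v := by
    cases f
    change v 0 + v 1 = _
    simp [ordInterpretation, lin]
  relMap_iff r v := by
    cases r
    change v 0 ≤ v 1 ↔ _
    simp [ordInterpretation, lin]

omit [IsOrderedAddMonoid G] in
theorem unordInterpretation_models : unordInterpretation.Models G where
  funMap_eq f v := by
    cases f
    · change (1 : G) = _
      simp [unordInterpretation, lin]
    · change v 0 + v 1 = _
      simp [unordInterpretation, lin]
  relMap_iff r v := nomatch r

theorem IsPresburger.isOrderedZGroup (hG : IsPresburger G) : IsOrderedZGroup G := by
  have h := elementarilyEquivalent isPresburger_int hG ordInterpretation_models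
    ordInterpretation_models
  unfold IsOrderedZGroup
  rw [show ordLang.completeTheory ℤ = ordLang.completeTheory G from h]
  infer_instance

end Models

theorem HasIntDivision.isUnorderedZGroup {G : Type*} [AddCommGroup G] [One G]
    (hG : HasIntDivision G) : IsUnorderedZGroup G := by
  obtain ⟨_, _, hG'⟩ := hG.exists_isPresburger
  have h := elementarilyEquivalent isPresburger_int hG' unordInterpretation_models
    unordInterpretation_models
  unfold IsUnorderedZGroup
  rw [show unordLang.completeTheory ℤ = unordLang.completeTheory G from h]
  infer_instance

/-- No nonzero element is divisible by all positive integers. -/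
def ResiduallySeparated (G : Type*) [AddCommGroup G] : Prop :=
  ∀ x : G, (∀ n : ℕ, 0 < n → ∃ y : G, x = n • y) → x = 0

/-- An infinite `x` dominates every constant, so the sign is lexicographic in `(c, d)` and does not
depend on `x`. All positive infinite elements therefore have the same signs. -/
theorem exists_zsmul_add_nonneg_iff {G : Type*} [AddCommGroup G] [LinearOrder G]
    [IsOrderedAddMonoid G] [One G] (hG : IsPresburger G) {x : G}
    (hx : ∀ n : ℕ, n • (1 : G) < x) (c d : ℤ) :
    0 ≤ c • x + d • (1 : G) ↔ 0 < c ∨ c = 0 ∧ 0 ≤ d := by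
  have key : ∀ (c d : ℤ), 0 < c → 0 < c • x + d • (1 : G) := by
    intro c d hc
    have h0 : 0 < x := by simpa using hx 0
    have h1 : x ≤ c • x := by
      have := (zsmul_le_zsmul_iff_left h0).2 (show 1 ≤ c by omega)
      simpa using this
    have h2 : (-d) • (1 : G) ≤ d.natAbs • (1 : G) := by
      rw [← natCast_zsmul, zsmul_le_zsmul_iff_left hG.one_pos]
      omega
    rw [neg_zsmul] at h2
    have := neg_lt_iff_pos_add.1 ((h2.trans_lt (hx _)).trans_le h1)
    exact this
  rcases lt_trichotomy c 0 with h | rfl | h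
  · refine iff_of_false (not_le.2 ?_) (by omega)
    have := key (-c) (-d) (by omega)
    rw [neg_zsmul, neg_zsmul, ← neg_add, neg_pos] at this
    exact this
  · simp [hG.zsmul_one_nonneg]
  · exact iff_of_true (key c d h).le (Or.inl h)

/-- Elements of a Leibnizian model of Presburger arithmetic are determined by their residues, for
any interpreted language. -/
theorem IsPresburger.residuallySeparated {L : Language} {I : LinearInterpretation L} {G : Type*}
    [AddCommGroup G] [LinearOrder G] [IsOrderedAddMonoid G] [One G] [L.Structure G]
    (hG : IsPresburger G) (hI : I.Models G) (hL : IsLeibnizian L G) : ResiduallySeparated G := by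
  suffices h : ∀ x : G, 0 < x → ¬ ∀ n : ℕ, 0 < n → ∃ y : G, x = n • y by
    intro x hx
    rcases lt_trichotomy x 0 with h' | h' | h'
    · refine absurd (fun n hn => ?_) (h (-x) (by simpa using h'))
      obtain ⟨y, hy⟩ := hx n hn
      exact ⟨-y, by rw [hy, smul_neg]⟩
    · exact h'
    · exact absurd hx (h x h')
  intro x hx0 hx
  -- A standard `k > 0` is not divisible by `k + 1`, so `x` is infinite.
  have hinf : ∀ n : ℕ, n • (1 : G) < x := by
    intro n
    by_contra hle
    obtain ⟨k, hk⟩ := exists_nat_of_le hG.one_le n hx0.le (not_lt.1 hle)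
    obtain ⟨y, hy⟩ := hx (k + 1) (by omega)
    have hdvd := hG.dvd_of_nsmul_eq (k + 1) (by omega) y k (by rw [← hy, hk, natCast_zsmul])
    have hk0 : 0 < k := Nat.pos_of_ne_zero fun h => by simp [hk, h] at hx0
    have := Nat.le_of_dvd hk0 (by exact_mod_cast hdvd)
    omega
  have hinf2 : ∀ n : ℕ, n • (1 : G) < 2 • x := fun n =>
    (hinf n).trans (by rw [two_nsmul]; exact lt_add_of_pos_right _ hx0)
  -- Both `x` and `2 • x` are positive infinite with all residues zero, so no formula separates
  -- them.
  obtain ⟨φ, h1, h2⟩ := hL x (2 • x) (by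
    rw [two_nsmul]; exact (lt_add_of_pos_right _ hx0).ne)
  refine h2 ((realize_formula_iff hG hI (fun c d => ?_) (fun m hm => ?_) φ).1 h1)
  · rw [exists_zsmul_add_nonneg_iff hG hinf, exists_zsmul_add_nonneg_iff hG hinf2]
  · obtain ⟨y, hy⟩ := hx m hm
    exact ⟨0, ⟨y, by simpa using hy⟩, 2 • y, by rw [hy]; simp [smul_comm 2 m]⟩

theorem HasIntDivision.residuallySeparated {G : Type*} [AddCommGroup G] [One G]
    (hG : HasIntDivision G) (hL : IsLeibnizian unordLang G) : ResiduallySeparated G := by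
  obtain ⟨_, _, hG'⟩ := hG.exists_isPresburger
  exact hG'.residuallySeparated unordInterpretation_models hL

/-- Distinct elements have distinct residues modulo some `n`, with representatives in `[1, n]`. -/
theorem HasIntDivision.exists_residue {G : Type*} [AddCommGroup G] [One G]
    (hG : HasIntDivision G) (hs : ResiduallySeparated G) {a b : G} (hab : a ≠ b) :
    ∃ n r : ℕ, (∃ q : G, a = (n + 1) • q + (r + 1) • (1 : G)) ∧
      ¬ ∃ q : G, b = (n + 1) • q + (r + 1) • (1 : G) := by
  have h1 : ¬ ∀ n : ℕ, 0 < n → ∃ y : G, a - b = n • y := fun h => hab (sub_eq_zero.1 (hs _ h))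
  push Not at h1
  obtain ⟨n, hn, h1⟩ := h1
  obtain ⟨n, rfl⟩ := Nat.exists_eq_succ_of_ne_zero hn.ne'
  obtain ⟨k, q, hk⟩ := hG.exists_rem (n + 1) hn a
  -- The remainder is made positive because `nsmulTerm` only produces multiples `(r + 1) • 1`. The
  -- shift by `(n + 1) * (|k| + 1)` is large enough for that.
  obtain ⟨r, t, hr⟩ : ∃ (r : ℕ) (t : ℤ), k = ((n + 1 : ℕ) : ℤ) * t + ((r + 1 : ℕ) : ℤ) := by
    have h2 : 0 ≤ k + ((n + 1 : ℕ) : ℤ) * (|k| + 1) - 1 := by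
      have := neg_abs_le k
      push_cast
      nlinarith [abs_nonneg k]
    refine ⟨(k + ((n + 1 : ℕ) : ℤ) * (|k| + 1) - 1).toNat, -(|k| + 1), ?_⟩
    rw [Nat.cast_succ (Int.toNat _), Int.toNat_of_nonneg h2]
    ring
  have ha : a = (n + 1) • (q + t • (1 : G)) + (r + 1) • (1 : G) := by
    rw [hk, hr, add_zsmul, mul_zsmul, natCast_zsmul, natCast_zsmul, nsmul_add, add_assoc]
  refine ⟨n, r, ⟨_, ha⟩, ?_⟩
  rintro ⟨q', hq'⟩
  refine h1 (q + t • (1 : G) - q') ?_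
  rw [nsmul_sub, ha, hq', add_sub_add_right_eq_sub]

/-! ### Formulas -/

section Terms

variable {L : Language} {α : Type*}

/-- The term `(n + 1) • t`, for a binary function symbol `f` denoting addition. -/
def nsmulTerm (f : L.Functions 2) (n : ℕ) (t : L.Term α) : L.Term α :=
  n.rec t fun _ s => f.apply₂ s t

theorem realize_nsmulTerm {f : L.Functions 2} {G : Type*} [AddMonoid G] [L.Structure G]
    (hf : ∀ v : Fin 2 → G, Language.Structure.funMap f v = v 0 + v 1) (n : ℕ) (t : L.Term α)
    (v : α → G) : (nsmulTerm f n t).realize v = (n + 1) • t.realize v := by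
  induction n with
  | zero => simp [nsmulTerm]
  | succ n ih =>
    change ((f.apply₂ (nsmulTerm f n t) t).realize v) = _
    rw [Language.Term.realize_functions_apply₂, hf, succ_nsmul _ (n + 1)]
    simp [ih]

end Terms

open Language.BoundedFormula

/-- Addition in the language `{+, 1}`. -/
def unordAdd : unordLang.Functions 2 := UnordFunc.add

/-- The constant `1` of the language `{+, 1}`. -/
def unordOne : unordLang.Constants := UnordFunc.one

/-- Addition in the language `{+, ≤}`. -/
def ordAdd : ordLang.Functions 2 := OrdFunc.add

/-- The order relation of the language `{+, ≤}`. -/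
def ordLe : ordLang.Relations 2 := OrdRel.le

@[simp]
theorem funMap_unordAdd {G : Type*} [Add G] [One G] (v : Fin 2 → G) :
    Language.Structure.funMap unordAdd v = v 0 + v 1 := rfl

@[simp]
theorem unordOne_eq {G : Type*} [Add G] [One G] : ((unordOne : unordLang.Constants) : G) = 1 := rfl

@[simp]
theorem funMap_ordAdd {G : Type*} [Add G] [LE G] (v : Fin 2 → G) :
    Language.Structure.funMap ordAdd v = v 0 + v 1 := rfl

@[simp]
theorem relMap_ordLe {G : Type*} [Add G] [LE G] (v : Fin 2 → G) :
    Language.Structure.RelMap ordLe v ↔ v 0 ≤ v 1 := Iff.rfl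

@[simp]
theorem realize_nsmulTerm_unordAdd {G : Type*} [AddMonoid G] [One G] {α : Type*} (n : ℕ)
    (t : unordLang.Term α) (v : α → G) :
    (nsmulTerm unordAdd n t).realize v = (n + 1) • t.realize v :=
  realize_nsmulTerm (fun _ => rfl) n t v

@[simp]
theorem realize_nsmulTerm_ordAdd {G : Type*} [AddMonoid G] [LE G] {α : Type*} (n : ℕ)
    (t : ordLang.Term α) (v : α → G) :
    (nsmulTerm ordAdd n t).realize v = (n + 1) • t.realize v :=
  realize_nsmulTerm (fun _ => rfl) n t v

/-- The formula `∃ y, x = (n + 1) y + (r + 1) 1` in the language `{+, 1}`. -/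
def unordResidueFormula (n r : ℕ) : unordLang.Formula Unit :=
  ∃' ((Language.Term.var (Sum.inl ())) =' (unordAdd.apply₂
    (nsmulTerm unordAdd n &0) (nsmulTerm unordAdd r unordOne.term)))

theorem realize_unordResidueFormula {G : Type*} [AddCommGroup G] [One G] (n r : ℕ) (x : G) :
    (unordResidueFormula n r).Realize (fun _ => x) ↔
      ∃ q : G, x = (n + 1) • q + (r + 1) • (1 : G) := by
  simp [unordResidueFormula, Language.Formula.Realize, Fin.snoc]

/-- The formula expressing that `z` is zero and `o` is the least positive element. -/
def isUnitFormula {α : Type*} {n : ℕ} (z o : Fin n) : ordLang.BoundedFormula α n :=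
  (ordAdd.apply₂ &z &z =' &z) ⊓ (∼(ordLe.boundedFormula₂ &o &z) ⊓
    ∀' (ordLe.boundedFormula₂ &(Fin.last n) &z.castSucc ⊔
      ordLe.boundedFormula₂ &o.castSucc &(Fin.last n)))

theorem realize_isUnitFormula {G : Type*} [Add G] [LE G] {α : Type*} {n : ℕ} (z o : Fin n)
    (v : α → G) (xs : Fin n → G) : (isUnitFormula z o).Realize v xs ↔
      xs z + xs z = xs z ∧ ¬ xs o ≤ xs z ∧ ∀ w : G, w ≤ xs z ∨ xs o ≤ w := by
  simp [isUnitFormula, Language.Relations.boundedFormula₂]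

/-- The formula `∃ y, x = (n + 1) y + (r + 1) 1` in the language `{+, ≤}`. -/
def ordResidueFormula (n r : ℕ) : ordLang.Formula Unit :=
  ∃' ∃' (isUnitFormula 0 1 ⊓ ∃' ((Language.Term.var (Sum.inl ())) =' (ordAdd.apply₂
    (nsmulTerm ordAdd n &2) (nsmulTerm ordAdd r &1))))

theorem IsPresburger.isUnit_iff {G : Type*} [AddCommGroup G] [LinearOrder G] [One G]
    (hG : IsPresburger G) (z o : G) :
    (z + z = z ∧ ¬ o ≤ z ∧ ∀ w : G, w ≤ z ∨ o ≤ w) ↔ z = 0 ∧ o = 1 := by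
  constructor
  · rintro ⟨hz, h1, h2⟩
    obtain rfl : z = 0 := by simpa using hz
    exact ⟨rfl, le_antisymm ((h2 1).resolve_left (not_le.2 hG.one_pos)) (hG.one_le o (not_le.1 h1))⟩
  · rintro ⟨rfl, rfl⟩
    exact ⟨add_zero 0, not_le.2 hG.one_pos, fun w => (le_or_gt w 0).imp_right (hG.one_le w)⟩

theorem IsPresburger.realize_ordResidueFormula {G : Type*} [AddCommGroup G] [LinearOrder G] [One G]
    (hG : IsPresburger G) (n r : ℕ) (x : G) :
    (ordResidueFormula n r).Realize (fun _ => x) ↔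
      ∃ q : G, x = (n + 1) • q + (r + 1) • (1 : G) := by
  simp only [ordResidueFormula, Language.Formula.Realize, realize_ex, realize_inf,
    realize_isUnitFormula, hG.isUnit_iff]
  simp [Fin.snoc]

theorem HasIntDivision.isLeibnizian {G : Type*} [AddCommGroup G] [One G] (hG : HasIntDivision G)
    (hs : ResiduallySeparated G) : IsLeibnizian unordLang G := by
  intro a b hab
  obtain ⟨n, r, h1, h2⟩ := hG.exists_residue hs hab
  exact ⟨unordResidueFormula n r, (realize_unordResidueFormula n r a).2 h1,
    fun h => h2 ((realize_unordResidueFormula n r b).1 h)⟩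

/-- Residue classes stay definable without a symbol for `1`, since `1` is the least positive
element. -/
theorem IsPresburger.isLeibnizian {G : Type*} [AddCommGroup G] [LinearOrder G] [One G]
    (hG : IsPresburger G) (hs : ResiduallySeparated G) : IsLeibnizian ordLang G := by
  intro a b hab
  obtain ⟨n, r, h1, h2⟩ := hG.exists_residue hs hab
  exact ⟨ordResidueFormula n r, (hG.realize_ordResidueFormula n r a).2 h1,
    fun h => h2 ((hG.realize_ordResidueFormula n r b).1 h)⟩

/-! ### Algebra of abstract `ℤ`-groups -/

/-- Replaces an abstract structure by one coming from instances, so that algebraic lemmas apply to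
it. -/
theorem exists_eq_ordStructure {M : Type*} (s : ordLang.Structure M) :
    ∃ (_ : Add M) (_ : LE M), s = ordStructure M := by
  refine ⟨⟨fun a b => s.funMap ordAdd ![a, b]⟩, ⟨fun a b => s.RelMap ordLe ![a, b]⟩, ?_⟩
  ext n f v
  · cases f
    change s.funMap ordAdd v = s.funMap ordAdd ![v 0, v 1]
    congr 1
    exact List.ofFn_injective rfl
  · cases f
    change s.RelMap ordLe v ↔ s.RelMap ordLe ![v 0, v 1]
    rw [show v = ![v 0, v 1] from List.ofFn_injective rfl]
    rfl

theorem exists_eq_unordStructure {M : Type*} (s : unordLang.Structure M) :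
    ∃ (_ : Add M) (_ : One M), s = unordStructure M := by
  refine ⟨⟨fun a b => s.funMap unordAdd ![a, b]⟩, ⟨s.funMap unordOne ![]⟩, ?_⟩
  ext n f v
  · cases f
    · change s.funMap unordOne v = s.funMap unordOne ![]
      congr 1
      exact Subsingleton.elim _ _
    · change s.funMap unordAdd v = s.funMap unordAdd ![v 0, v 1]
      congr 1
      exact List.ofFn_injective rfl
  · cases f

/-- An abelian group structure extending a given addition. -/
theorem exists_addCommGroup {M : Type*} [A : Add M] (assoc : ∀ a b c : M, a + b + c = a + (b + c))
    (comm : ∀ a b : M, a + b = b + a)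
    (zero : ∃ z : M, (∀ a, a + z = a) ∧ ∀ a, ∃ b, a + b = z) :
    ∃ inst : AddCommGroup M, inst.toAdd = A := by
  obtain ⟨z, hz, hneg⟩ := zero
  choose neg hneg using hneg
  let _ : Zero M := ⟨z⟩
  let _ : Neg M := ⟨neg⟩
  exact ⟨{ AddGroup.ofLeftAxioms assoc (fun a => (comm _ _).trans (hz a))
    (fun a => (comm _ _).trans (hneg a)) with add_comm := comm }, rfl⟩

/-! ### Axioms as first-order sentences, and their transfer from `ℤ`. -/

section Sentences

variable {L : Language} (f : L.Functions 2)

/-- The sentence `∀ a b c, (a + b) + c = a + (b + c)`. -/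
def assocSentence : L.Sentence :=
  ∀' ∀' ∀' (f.apply₂ (f.apply₂ &0 &1) &2 =' f.apply₂ &0 (f.apply₂ &1 &2))

/-- The sentence `∀ a b, a + b = b + a`. -/
def commSentence : L.Sentence :=
  ∀' ∀' (f.apply₂ &0 &1 =' f.apply₂ &1 &0)

/-- The sentence expressing the existence of zero and negatives. -/
def zeroNegSentence : L.Sentence :=
  ∃' ((∀' (f.apply₂ &1 &0 =' &1)) ⊓ (∀' ∃' (f.apply₂ &1 &2 =' &0)))

theorem exists_addCommGroup_of_sentences {M : Type*} [L.Structure M] [A : Add M]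
    (hf : ∀ v : Fin 2 → M, Language.Structure.funMap f v = v 0 + v 1)
    (h1 : M ⊨ assocSentence f) (h2 : M ⊨ commSentence f) (h3 : M ⊨ zeroNegSentence f) :
    ∃ inst : AddCommGroup M, inst.toAdd = A := by
  simp [assocSentence, Language.Sentence.Realize, Language.Formula.Realize, hf, Fin.snoc] at h1
  simp [commSentence, Language.Sentence.Realize, Language.Formula.Realize, hf, Fin.snoc] at h2
  simp [zeroNegSentence, Language.Sentence.Realize, Language.Formula.Realize, hf, Fin.snoc] at h3
  exact exists_addCommGroup h1 h2 h3

theorem realize_groupSentences {M : Type*} [L.Structure M] [AddCommGroup M]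
    (hf : ∀ v : Fin 2 → M, Language.Structure.funMap f v = v 0 + v 1) :
    M ⊨ assocSentence f ∧ M ⊨ commSentence f ∧ M ⊨ zeroNegSentence f := by
  refine ⟨?_, ?_, ?_⟩
  · simp [assocSentence, Language.Sentence.Realize, Language.Formula.Realize, hf, Fin.snoc,
      add_assoc]
  · simp [commSentence, Language.Sentence.Realize, Language.Formula.Realize, hf, Fin.snoc,
      add_comm]
  · simp [zeroNegSentence, Language.Sentence.Realize, Language.Formula.Realize, hf, Fin.snoc]
    exact fun a => ⟨-a, add_neg_cancel a⟩

end Sentences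

/-- The sentence expressing that `≤` is a linear order. -/
def linearOrderSentence : ordLang.Sentence :=
  (∀' (ordLe.boundedFormula₂ &0 &0)) ⊓
  ((∀' ∀' ∀' (ordLe.boundedFormula₂ &0 &1 ⟹ ordLe.boundedFormula₂ &1 &2 ⟹
    ordLe.boundedFormula₂ &0 &2)) ⊓
  ((∀' ∀' (ordLe.boundedFormula₂ &0 &1 ⟹ ordLe.boundedFormula₂ &1 &0 ⟹ &0 =' &1)) ⊓
  (∀' ∀' (ordLe.boundedFormula₂ &0 &1 ⊔ ordLe.boundedFormula₂ &1 &0))))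

theorem realize_linearOrderSentence {M : Type*} [Add M] [LE M] :
    M ⊨ linearOrderSentence ↔ (∀ a : M, a ≤ a) ∧ (∀ a b c : M, a ≤ b → b ≤ c → a ≤ c) ∧
      (∀ a b : M, a ≤ b → b ≤ a → a = b) ∧ ∀ a b : M, a ≤ b ∨ b ≤ a := by
  simp [linearOrderSentence, Language.Sentence.Realize, Language.Formula.Realize, Fin.snoc,
    Language.Relations.boundedFormula₂]

/-- The sentence expressing that addition is monotone. -/
def addMonoSentence : ordLang.Sentence :=
  ∀' ∀' ∀' (ordLe.boundedFormula₂ &0 &1 ⟹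
    ordLe.boundedFormula₂ (ordAdd.apply₂ &0 &2) (ordAdd.apply₂ &1 &2))

theorem realize_addMonoSentence {M : Type*} [Add M] [LE M] :
    M ⊨ addMonoSentence ↔ ∀ a b c : M, a ≤ b → a + c ≤ b + c := by
  simp [addMonoSentence, Language.Sentence.Realize, Language.Formula.Realize, Fin.snoc,
    Language.Relations.boundedFormula₂]

/-- The sentence expressing that there is a least positive element. -/
def existsUnitSentence : ordLang.Sentence := ∃' ∃' (isUnitFormula 0 1)

theorem realize_existsUnitSentence {M : Type*} [Add M] [LE M] :
    M ⊨ existsUnitSentence ↔ ∃ z o : M, z + z = z ∧ ¬ o ≤ z ∧ ∀ w : M, w ≤ z ∨ o ≤ w := by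
  simp only [existsUnitSentence, Language.Sentence.Realize, Language.Formula.Realize, realize_ex,
    realize_isUnitFormula]
  simp [Fin.snoc]

/-- The sentence expressing that every element lies between consecutive multiples of `n + 1`. -/
def ordDivisionSentence (n : ℕ) : ordLang.Sentence :=
  ∀' ∀' (isUnitFormula 0 1 ⟹ ∀' ∃' (ordLe.boundedFormula₂ (nsmulTerm ordAdd n &3) &2 ⊓
    ∼(ordLe.boundedFormula₂ (nsmulTerm ordAdd n (ordAdd.apply₂ &3 &1)) &2)))

theorem realize_ordDivisionSentence {M : Type*} [AddMonoid M] [LE M] (n : ℕ) :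
    M ⊨ ordDivisionSentence n ↔ ∀ z o : M, (z + z = z ∧ ¬ o ≤ z ∧ ∀ w : M, w ≤ z ∨ o ≤ w) →
      ∀ x : M, ∃ y, (n + 1) • y ≤ x ∧ ¬ (n + 1) • (y + o) ≤ x := by
  simp only [ordDivisionSentence, Language.Sentence.Realize, Language.Formula.Realize,
    realize_all, realize_imp, realize_isUnitFormula]
  simp [Fin.snoc, Language.Relations.boundedFormula₂]

theorem exists_isPresburger_of_isOrderedZGroup {M : Type*} [s : ordLang.Structure M]
    (h : IsOrderedZGroup M) : ∃ (_ : AddCommGroup M) (_ : LinearOrder M) (_ : IsOrderedAddMonoid M)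
      (_ : One M), s = ordStructure M ∧ IsPresburger M := by
  classical
  have tr : ∀ φ : ordLang.Sentence, ℤ ⊨ φ → M ⊨ φ := fun φ =>
    haveI : M ⊨ ordLang.completeTheory ℤ := h
    (Language.realize_iff_of_model_completeTheory ℤ M φ).2
  clear h
  obtain ⟨A, O, rfl⟩ := exists_eq_ordStructure s
  obtain ⟨ha, hb, hc⟩ := realize_groupSentences (M := ℤ) ordAdd fun _ => rfl
  obtain ⟨iG, rfl⟩ := exists_addCommGroup_of_sentences (M := M) ordAdd (fun _ => rfl)
    (tr _ ha) (tr _ hb) (tr _ hc)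
  obtain ⟨hrefl, htrans, hanti, htotal⟩ := realize_linearOrderSentence.1
    (tr _ (realize_linearOrderSentence.2 ⟨le_refl, fun _ _ _ => le_trans, fun _ _ => le_antisymm,
      le_total⟩))
  have hmono := realize_addMonoSentence.1
    (tr _ (realize_addMonoSentence.2 fun a b c h => add_le_add_left h c))
  -- The language has no constants; the witness `o` becomes the `1` of `M`.
  obtain ⟨z, o, hzo⟩ := realize_existsUnitSentence.1
    (tr _ (realize_existsUnitSentence.2 ⟨0, 1, (isPresburger_int.isUnit_iff 0 1).2 ⟨rfl, rfl⟩⟩))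
  have hdiv : ∀ n : ℕ, _ := fun n => realize_ordDivisionSentence (M := M) n |>.1 <| tr _ <|
    (realize_ordDivisionSentence n).2 <| by
      intro z o hzo x
      obtain ⟨rfl, rfl⟩ := (isPresburger_int.isUnit_iff z o).1 hzo
      have h1 := Int.mul_ediv_add_emod x (n + 1)
      have h2 := Int.emod_nonneg x (show (n + 1 : ℤ) ≠ 0 by omega)
      have h3 := Int.emod_lt_of_pos x (show (0 : ℤ) < n + 1 by omega)
      refine ⟨x / (n + 1), ?_, ?_⟩
      · simp only [nsmul_eq_mul]; push_cast; linarith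
      · simp only [nsmul_eq_mul, not_le]; push_cast; linarith
  let iO : LinearOrder M :=
    { O with
      le_refl := hrefl
      le_trans := htrans
      le_antisymm := hanti
      le_total := htotal
      toDecidableLE := Classical.decRel _ }
  have iOA : IsOrderedAddMonoid M := { add_le_add_left := fun a b h c => hmono a b c h }
  have hz0 : z = 0 := by simpa using hzo.1
  let iOne : One M := ⟨o⟩
  have h1 : ∀ x : M, 0 < x → 1 ≤ x := fun x hx =>
    (hzo.2.2 x).resolve_left (by rw [hz0]; exact not_le.2 hx)
  refine ⟨iG, iO, iOA, iOne, rfl, isPresburger_of_division ?_ h1 ?_⟩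
  · have := hzo.2.1
    rw [hz0] at this
    exact not_le.1 this
  · intro n hn x
    obtain ⟨n, rfl⟩ := Nat.exists_eq_succ_of_ne_zero hn.ne'
    obtain ⟨y, hy, hy'⟩ := hdiv n z o hzo x
    -- The remainder lies between `0` and `(n + 1) • 1`, so discreteness makes it a standard
    -- multiple of `1`.
    obtain ⟨k, hk⟩ := exists_nat_of_le h1 (n + 1) (x := x - (n + 1) • y) (sub_nonneg.2 hy) (by
      have := (not_le.1 hy').le
      rw [nsmul_add] at this
      rw [sub_le_iff_le_add']
      exact this)
    exact ⟨k, y, by rw [natCast_zsmul, ← hk]; simp⟩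

/-- The sentence expressing that multiplication by `n + 1` is injective. -/
def torsionFreeSentence (n : ℕ) : unordLang.Sentence :=
  ∀' ∀' ((nsmulTerm unordAdd n &0 =' nsmulTerm unordAdd n &1) ⟹ &0 =' &1)

theorem realize_torsionFreeSentence {M : Type*} [AddMonoid M] [One M] (n : ℕ) :
    M ⊨ torsionFreeSentence n ↔ ∀ x y : M, (n + 1) • x = (n + 1) • y → x = y := by
  simp [torsionFreeSentence, Language.Sentence.Realize, Language.Formula.Realize, Fin.snoc]

/-- The sentence expressing that `(r + 1) 1` is not divisible by `n + 1`. -/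
def notDvdSentence (n r : ℕ) : unordLang.Sentence :=
  ∀' ∼(nsmulTerm unordAdd n &0 =' nsmulTerm unordAdd r unordOne.term)

theorem realize_notDvdSentence {M : Type*} [AddMonoid M] [One M] (n r : ℕ) :
    M ⊨ notDvdSentence n r ↔ ∀ x : M, (n + 1) • x ≠ (r + 1) • (1 : M) := by
  simp [notDvdSentence, Language.Sentence.Realize, Language.Formula.Realize, Fin.snoc]

/-- The sentence expressing division with remainder by `n + 1`. -/
noncomputable def unordDivisionSentence (n : ℕ) : unordLang.Sentence :=
  ∀' ∃' (iSup fun r : Fin (n + 1) => &0 =' unordAdd.apply₂ (nsmulTerm unordAdd n &1)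
    (nsmulTerm unordAdd r unordOne.term))

theorem realize_unordDivisionSentence {M : Type*} [AddMonoid M] [One M] (n : ℕ) :
    M ⊨ unordDivisionSentence n ↔
      ∀ x : M, ∃ y, ∃ r : Fin (n + 1), x = (n + 1) • y + ((r : ℕ) + 1) • (1 : M) := by
  simp [unordDivisionSentence, Language.Sentence.Realize, Language.Formula.Realize, Fin.snoc]

theorem exists_hasIntDivision_of_isUnorderedZGroup {M : Type*} [s : unordLang.Structure M]
    (h : IsUnorderedZGroup M) : ∃ (_ : AddCommGroup M) (_ : One M), s = unordStructure M ∧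
      HasIntDivision M := by
  have tr : ∀ φ : unordLang.Sentence, ℤ ⊨ φ → M ⊨ φ := fun φ =>
    haveI : M ⊨ unordLang.completeTheory ℤ := h
    (Language.realize_iff_of_model_completeTheory ℤ M φ).2
  clear h
  obtain ⟨A, O, rfl⟩ := exists_eq_unordStructure s
  obtain ⟨ha, hb, hc⟩ := realize_groupSentences (M := ℤ) unordAdd fun _ => rfl
  obtain ⟨iG, rfl⟩ := exists_addCommGroup_of_sentences (M := M) unordAdd (fun _ => rfl)
    (tr _ ha) (tr _ hb) (tr _ hc)
  refine ⟨iG, O, rfl, ?_, ?_, ?_⟩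
  · intro n hn x hx
    obtain ⟨n, rfl⟩ := Nat.exists_eq_succ_of_ne_zero hn.ne'
    refine (realize_torsionFreeSentence n).1 (tr _ ((realize_torsionFreeSentence n).2 ?_)) x 0 ?_
    · intro x y hxy
      exact isPresburger_int.nsmul_left_cancel hn hxy
    · rw [smul_zero]; exact hx
  · intro n hn x k hx
    by_contra hdvd
    obtain ⟨n, rfl⟩ := Nat.exists_eq_succ_of_ne_zero hn.ne'
    have hr0 : 0 < k % ((n + 1 : ℕ) : ℤ) :=
      lt_of_le_of_ne (Int.emod_nonneg _ (by omega)) fun h => hdvd (Int.dvd_of_emod_eq_zero h.symm)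
    have hrn := Int.emod_lt_of_pos k (show (0 : ℤ) < ((n + 1 : ℕ) : ℤ) by omega)
    obtain ⟨r, hr⟩ : ∃ r : ℕ, k % ((n + 1 : ℕ) : ℤ) = ((r + 1 : ℕ) : ℤ) :=
      ⟨(k % ((n + 1 : ℕ) : ℤ) - 1).toNat, by omega⟩
    -- Subtracting the integer quotient reduces `k` to its remainder `r + 1`, between `1` and `n`,
    -- where a single sentence applies.
    refine (realize_notDvdSentence n r).1 (tr _ ((realize_notDvdSentence n r).2 ?_))
      (x - (k / ((n + 1 : ℕ) : ℤ)) • (1 : M)) ?_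
    · intro y hy
      have := isPresburger_int.dvd_of_nsmul_eq (n + 1) hn y ((r + 1 : ℕ) : ℤ)
        (by rw [hy, natCast_zsmul])
      have := Int.le_of_dvd (by omega) this
      omega
    · rw [nsmul_sub, ← natCast_zsmul (1 : M), ← hr, ← natCast_zsmul (_ • (1 : M)), ← mul_zsmul]
      change (n + 1) • x - _ = _
      rw [sub_eq_iff_eq_add, ← add_zsmul, Int.emod_add_mul_ediv]
      exact hx
  · intro n hn x
    obtain ⟨n, rfl⟩ := Nat.exists_eq_succ_of_ne_zero hn.ne'
    obtain ⟨y, r, h⟩ := (realize_unordDivisionSentence n).1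
      (tr _ ((realize_unordDivisionSentence n).2 fun x => by
        -- Dividing `x - 1` turns a remainder `k` in `[0, n]` into `k + 1`.
        obtain ⟨k, q, hk, h⟩ := isPresburger_int.exists_rem_range hn (x - 1)
        exact ⟨q, ⟨k, hk⟩, by
          rw [succ_nsmul _ k, ← add_assoc]
          exact sub_eq_iff_eq_add.1 h⟩)) x
    exact ⟨((r + 1 : ℕ) : ℤ), y, by rw [natCast_zsmul]; exact h⟩

/-! ### The profinite integers -/

namespace ZHat

/-- The residue of a profinite integer modulo `n`. -/
def res (n : ℕ+) : ZHat →+* ZMod n :=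
  ((Pi.evalRingHom (fun n : ℕ+ => ZMod n) n).comp zhatSubring.subtype : zhatSubring →+* ZMod n)

theorem ext {x y : ZHat} (h : ∀ n, res n x = res n y) : x = y :=
  Subtype.ext (funext h)

theorem exists_of_compatible (f : ∀ n : ℕ+, ZMod n)
    (hf : ∀ (m n : ℕ+) (h : (m : ℕ) ∣ (n : ℕ)), ZMod.castHom h (ZMod m) (f n) = f m) :
    ∃ x : ZHat, ∀ n, res n x = f n :=
  ⟨(⟨f, hf⟩ : zhatSubring), fun _ => rfl⟩

theorem exists_nat_res (x : ZHat) (k : ℕ+) :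
    ∃ a : ℕ, ∀ m : ℕ+, (m : ℕ) ∣ (k : ℕ) → res m x = (a : ZMod m) := by
  refine ⟨(res k x).val, fun m h => ?_⟩
  have h1 : ZMod.castHom h (ZMod m) (res k x) = res m x := x.2 m k h
  have h2 : (((res k x).val : ℕ) : ZMod k) = res k x := ZMod.natCast_zmod_val _
  rw [← h1]
  conv_lhs => rw [← h2]
  rw [map_natCast]

/-- Division by `n` costs a factor `n` in the modulus: `y` modulo `m` is `a / n`, where `a`
represents `x` modulo `n * m`. Cancelling `n` in the congruences modulo `n * m` gives compatibility.
-/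
theorem exists_nsmul_of_res_eq_zero {n : ℕ+} {x : ZHat} (hx : res n x = 0) :
    ∃ y : ZHat, x = (n : ℕ) • y := by
  choose a ha using exists_nat_res x
  have hdvd : ∀ m : ℕ+, (n : ℕ) ∣ a (n * m) := fun m => by
    rw [← ZMod.natCast_eq_zero_iff, ← ha (n * m) n (by simp), hx]
  choose b hb using hdvd
  obtain ⟨y, hy⟩ := exists_of_compatible (fun m => (b m : ZMod m)) (by
    intro m k h
    simp only [map_natCast]
    rw [ZMod.natCast_eq_natCast_iff]
    have h1 : a (n * k) ≡ a (n * m) [MOD n * m] := by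
      have h2 := ha (n * k) (n * m) (by simpa using Nat.mul_dvd_mul_left _ h)
      rw [ha (n * m) (n * m) dvd_rfl, ZMod.natCast_eq_natCast_iff] at h2
      simpa using h2.symm
    rw [hb, hb] at h1
    exact Nat.ModEq.mul_left_cancel' n.ne_zero h1)
  refine ⟨y, ext fun m => ?_⟩
  rw [map_nsmul, hy, ha (n * m) m (by simp), hb, Nat.cast_mul, nsmul_eq_mul]

theorem hasIntDivision : HasIntDivision ZHat where
  eq_zero_of_nsmul n hn x hx := by
    lift n to ℕ+ using hn
    refine ext fun m => ?_
    obtain ⟨a, ha⟩ := exists_nat_res x (n * m)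
    have h1 := congrArg (res (n * m)) hx
    rw [map_nsmul, ha _ dvd_rfl, map_zero, nsmul_eq_mul, ← Nat.cast_mul, ZMod.natCast_eq_zero_iff,
      PNat.mul_coe] at h1
    rw [ha m (by simp), map_zero, ZMod.natCast_eq_zero_iff]
    exact Nat.dvd_of_mul_dvd_mul_left n.pos h1
  dvd_of_nsmul_eq n hn x k hx := by
    lift n to ℕ+ using hn
    have h1 := congrArg (res n) hx
    rw [map_nsmul, map_zsmul, map_one, nsmul_eq_mul, ZMod.natCast_self, zero_mul, zsmul_eq_mul,
      mul_one] at h1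
    exact (ZMod.intCast_zmod_eq_zero_iff_dvd _ _).1 h1.symm
  exists_rem n hn x := by
    lift n to ℕ+ using hn
    obtain ⟨a, ha⟩ := exists_nat_res x n
    obtain ⟨y, hy⟩ := exists_nsmul_of_res_eq_zero (n := n) (x := x - a)
      (by rw [map_sub, ha n dvd_rfl, map_natCast, sub_self])
    exact ⟨a, y, by rw [← hy]; simp⟩

theorem res_nsmul (n : ℕ+) (y : ZHat) : res n ((n : ℕ) • y) = 0 := by
  rw [map_nsmul, nsmul_eq_mul, ZMod.natCast_self, zero_mul]

theorem residuallySeparated : ResiduallySeparated ZHat := by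
  intro x hx
  refine ext fun n => ?_
  obtain ⟨y, rfl⟩ := hx n n.pos
  rw [res_nsmul, map_zero]

end ZHat

/-! ### Pure embeddings into the profinite integers. -/

section PureEmbedding

variable {G : Type*} [AddCommGroup G] [One G]

/-- A group with a pure embedding into `ZHat` has division with remainder. -/
theorem hasIntDivision_of_pure {f : G →+ ZHat} (hf : Function.Injective f) (h1 : f 1 = 1)
    (hp : ∀ n : ℕ, 0 < n → ∀ x : G, (∃ b, f x = n • b) → ∃ y, x = n • y) : HasIntDivision G where
  eq_zero_of_nsmul n hn x hx := hf (by
    rw [map_zero]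
    exact ZHat.hasIntDivision.eq_zero_of_nsmul n hn _ (by rw [← map_nsmul, hx, map_zero]))
  dvd_of_nsmul_eq n hn x k hx := ZHat.hasIntDivision.dvd_of_nsmul_eq n hn (f x) k (by
    rw [← map_nsmul, hx, map_zsmul, h1])
  exists_rem n hn x := by
    obtain ⟨k, q, h⟩ := ZHat.hasIntDivision.exists_rem n hn (f x)
    obtain ⟨y, hy⟩ := hp n hn (x - k • (1 : G)) ⟨q, by rw [map_sub, map_zsmul, h1, h]; abel⟩
    exact ⟨k, y, by rw [← hy]; abel⟩

omit [One G] in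
theorem residuallySeparated_of_injective {f : G →+ ZHat} (hf : Function.Injective f) :
    ResiduallySeparated G := by
  intro x hx
  refine hf ?_
  rw [map_zero]
  refine ZHat.residuallySeparated _ fun n hn => ?_
  obtain ⟨y, rfl⟩ := hx n hn
  exact ⟨f y, map_nsmul f n y⟩

/-- The map from a group with division with remainder to `ZHat` given by its residues. -/
theorem HasIntDivision.exists_toZHat (hG : HasIntDivision G) :
    ∃ f : G →+ ZHat, f 1 = 1 ∧
      ∀ (n : ℕ) (_ : 0 < n) (x : G), (∃ b, f x = n • b) → ∃ y, x = n • y := by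
  choose r q hr using fun (x : G) (n : ℕ+) => hG.exists_rem n n.pos x
  -- Uniqueness of residues: each identity between residues below is proved by exhibiting the
  -- difference of representatives as a multiple of `n` in `G`.
  have huniq : ∀ (n : ℕ+) (k l : ℤ) (y : G), (n : ℕ) • y = (k - l) • (1 : G) →
      (k : ZMod n) = l := by
    intro n k l y h
    have := hG.dvd_of_nsmul_eq n n.pos y _ h
    rw [← (ZMod.intCast_zmod_eq_zero_iff_dvd _ _), Int.cast_sub, sub_eq_zero] at this
    exact this
  have hex : ∀ x, ∃ z : ZHat, ∀ n, ZHat.res n z = (r x n : ZMod n) := by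
    intro x
    refine ZHat.exists_of_compatible _ fun m n h => ?_
    rw [map_intCast]
    obtain ⟨t, ht⟩ := h
    refine huniq m _ _ (q x m - t • q x n) ?_
    have := (hr x m).symm.trans (hr x n)
    rw [ht, mul_nsmul'] at this
    rw [sub_smul, nsmul_sub, sub_eq_sub_iff_add_eq_add, add_comm (r x n • (1 : G)), ← this]
  choose g hg using hex
  refine ⟨⟨⟨g, ?_⟩, ?_⟩, ?_, ?_⟩
  · refine ZHat.ext fun n => ?_
    rw [hg, map_zero, ← Int.cast_zero]
    refine huniq n _ _ (-q 0 n) ?_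
    rw [sub_zero, smul_neg, neg_eq_iff_add_eq_zero]
    exact (hr 0 n).symm
  · intro x y
    refine ZHat.ext fun n => ?_
    simp only [map_add, hg]
    rw [← Int.cast_add]
    refine huniq n _ _ (q x n + q y n - q (x + y) n) ?_
    have h3 := hr (x + y) n
    conv_lhs at h3 => rw [hr x n, hr y n]
    rw [sub_smul, nsmul_sub, sub_eq_sub_iff_add_eq_add, nsmul_add, add_zsmul,
      add_comm (r (x + y) n • (1 : G)), ← h3]
    abel
  · refine ZHat.ext fun n => ?_
    change ZHat.res n (g 1) = _
    rw [hg, map_one, ← Int.cast_one]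
    refine huniq n _ _ (-q 1 n) ?_
    rw [sub_smul, one_zsmul]
    conv_rhs => rhs; rw [hr 1 n]
    rw [smul_neg]; abel
  · rintro n hn x ⟨b, hb⟩
    lift n to ℕ+ using hn
    have h1 : ZHat.res n (g x) = 0 := by
      rw [show g x = (n : ℕ) • b from hb, ZHat.res_nsmul]
    rw [hg, ZMod.intCast_zmod_eq_zero_iff_dvd] at h1
    obtain ⟨t, ht⟩ := h1
    refine ⟨q x n + t • (1 : G), ?_⟩
    conv_lhs => rw [hr x n, ht]
    rw [nsmul_add, mul_zsmul, natCast_zsmul]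

omit [One G] in
-- An element of the kernel maps to `0 = n • 0`, so purity makes it divisible by every `n` in `G`.
theorem injective_of_residuallySeparated (hs : ResiduallySeparated G) {f : G →+ ZHat}
    (hp : ∀ n : ℕ, 0 < n → ∀ x : G, (∃ b, f x = n • b) → ∃ y, x = n • y) :
    Function.Injective f := by
  rw [injective_iff_map_eq_zero]
  intro x hx
  exact hs x fun n hn => hp n hn x ⟨0, by rw [hx, smul_zero]⟩

theorem isZSubgroup_range {f : G →+ ZHat} (h1 : f 1 = 1)
    (hp : ∀ n : ℕ, 0 < n → ∀ x : G, (∃ b, f x = n • b) → ∃ y, x = n • y) :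
    IsZSubgroup (Set.range f) := by
  refine ⟨f.range, rfl, ⟨1, h1⟩, ?_⟩
  rintro n hn _ ⟨x, rfl⟩ hb
  obtain ⟨y, rfl⟩ := hp n hn x hb
  exact ⟨f y, ⟨y, rfl⟩, map_nsmul f n y⟩

end PureEmbedding

/-! ### Leibnizian `ℤ`-groups as subgroups of `ZHat` -/

section Equiv

variable {L : Language} {M N : Type*} [L.Structure M] [L.Structure N]

theorem IsLeibnizian.of_equiv (e : M ≃[L] N) (h : IsLeibnizian L N) : IsLeibnizian L M := by
  intro a b hab
  obtain ⟨φ, h1, h2⟩ := h (e a) (e b) fun h => hab (e.injective h)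
  exact ⟨φ, (Language.StrongHomClass.realize_formula e φ).1 h1,
    fun h => h2 ((Language.StrongHomClass.realize_formula e φ).2 h)⟩

theorem model_of_equiv (T : L.Theory) (e : M ≃[L] N) (h : N ⊨ T) : M ⊨ T :=
  (Language.StrongHomClass.theory_model e.symm (T := T))

end Equiv

theorem leibnizian_unordered_iff (M : Type*) [s : unordLang.Structure M] :
    (IsUnorderedZGroup M ∧ IsLeibnizian unordLang M) ↔
      ∃ H : unordLang.Substructure ZHat,
        IsZSubgroup (H : Set ZHat) ∧ Nonempty (M ≃[unordLang] H) := by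
  constructor
  · rintro ⟨hM, hL⟩
    obtain ⟨_, _, rfl, hG⟩ := exists_hasIntDivision_of_isUnorderedZGroup hM
    obtain ⟨f, h1, hp⟩ := hG.exists_toZHat
    have hf := injective_of_residuallySeparated (hG.residuallySeparated hL) hp
    let F : M ↪[unordLang] ZHat :=
      { toFun := f
        inj' := hf
        map_fun' := by
          rintro n (_ | _) v
          · exact h1
          · exact map_add f _ _
        map_rel' := fun r => nomatch r }
    exact ⟨F.toHom.range, isZSubgroup_range h1 hp, ⟨F.equivRange⟩⟩
  · rintro ⟨H, ⟨H', hH, h1, hp⟩, ⟨e⟩⟩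
    let _ : One H' := ⟨⟨1, h1⟩⟩
    let F : H' ↪[unordLang] ZHat :=
      { toFun := H'.subtype
        inj' := Subtype.val_injective
        map_fun' := by rintro n (_ | _) v <;> rfl
        map_rel' := fun r => nomatch r }
    obtain rfl : F.toHom.range = H := SetLike.coe_injective <| by
      rw [← hH]; exact Subtype.range_coe
    have hG : HasIntDivision H' := hasIntDivision_of_pure (f := H'.subtype)
      Subtype.val_injective rfl fun n hn x hb => by
        obtain ⟨y, hy, h⟩ := hp n hn x x.2 hb
        exact ⟨⟨y, hy⟩, Subtype.ext h⟩
    have e' : M ≃[unordLang] H' := F.equivRange.symm.comp e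
    exact ⟨model_of_equiv _ e' hG.isUnorderedZGroup, (hG.isLeibnizian
      (residuallySeparated_of_injective (f := H'.subtype) Subtype.val_injective)).of_equiv e'⟩

theorem mk_zHat_eq_zero_iff (x : ZHat) : (x : ZHatModZ) = 0 ↔ ∃ k : ℤ, x = k • (1 : ZHat) := by
  rw [QuotientAddGroup.eq_zero_iff, AddSubgroup.mem_zmultiples_iff]
  exact ⟨fun ⟨k, h⟩ => ⟨k, h.symm⟩, fun ⟨k, h⟩ => ⟨k, h.symm⟩⟩

/-- The order of a group with a pure embedding into `ZHat` is induced by an order on `ZHat / ℤ`. -/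
theorem IsPresburger.exists_order_zHatModZ {G : Type*} [AddCommGroup G] [LinearOrder G]
    [IsOrderedAddMonoid G] [One G] (hG : IsPresburger G) {f : G →+ ZHat}
    (hf : Function.Injective f) (h1 : f 1 = 1) :
    ∃ (_ : LinearOrder ZHatModZ) (_ : IsOrderedAddMonoid ZHatModZ),
      ∀ x y : G, f x ≤ f y ↔ x ≤ y := by
  let g : G →+ ZHatModZ := (QuotientAddGroup.mk' _).comp f
  have hg : ∀ x, g x = 0 ↔ ∃ k : ℤ, x = k • (1 : G) := by
    intro x
    refine (mk_zHat_eq_zero_iff (f x)).trans (exists_congr fun k => ?_)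
    rw [← h1, ← map_zsmul, hf.eq_iff]
  -- The image of the non-negative cone is pointed: if `g y = -g x` with `x, y ≥ 0`, then `x + y` is
  -- standard, hence so is `x`, which lies between `0` and it, and `g x = 0`. The extension is
  -- needed because `g` need not be onto.
  obtain ⟨lo, ho, hC⟩ := exists_linearOrder_extending ZHat.hasIntDivision.torsionFree_quotient
    ((AddSubmonoid.nonneg G).map g) (by
      rintro _ ⟨x, hx, rfl⟩ ⟨y, hy, hxy⟩
      have hx : 0 ≤ x := hx
      have hy : 0 ≤ y := hy
      have h0 : g (y + x) = 0 := by rw [map_add, hxy, neg_add_cancel]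
      obtain ⟨k, hk⟩ := (hg _).1 h0
      have hk' : x ≤ k.natAbs • (1 : G) := by
        refine (le_add_of_nonneg_left hy).trans ?_
        rw [hk, ← natCast_zsmul, zsmul_le_zsmul_iff_left hG.one_pos]
        omega
      obtain ⟨l, hl⟩ := exists_nat_of_le hG.one_le _ hx hk'
      exact (hg x).2 ⟨l, by rw [hl, natCast_zsmul]⟩)
  have hC' : ∀ x : G, 0 ≤ x → 0 ≤ g x := fun x hx => hC _ ⟨x, hx, rfl⟩
  refine ⟨lo, ho, fun x y => ?_⟩
  change LexNonneg (f y - f x) ↔ _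
  rw [← map_sub, ← sub_nonneg (a := y)]
  generalize y - x = z
  change (0 < g z ∨ ∃ n : ℕ, f z = n) ↔ _
  have hnat : ∀ n : ℕ, f z = n ↔ z = n • (1 : G) := fun n => by
    rw [← hf.eq_iff, map_nsmul, h1, nsmul_one]
  simp only [hnat]
  constructor
  · rintro (h | ⟨n, rfl⟩)
    · by_contra hz
      have := hC' (-z) (by simpa using (not_le.1 hz).le)
      rw [map_neg, neg_nonneg] at this
      exact absurd h this.not_gt
    · exact nsmul_nonneg hG.one_pos.le n
  · intro hz
    rcases (hC' z hz).eq_or_lt with h | h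
    · obtain ⟨k, rfl⟩ := (hg z).1 h.symm
      rw [hG.zsmul_one_nonneg] at hz
      exact Or.inr ⟨k.toNat, by rw [← natCast_zsmul, Int.toNat_of_nonneg hz]⟩
    · exact Or.inl h

/-- A group with a pure embedding into `ZHat` inherits the lexicographic order. -/
theorem exists_isPresburger_of_pure [LinearOrder ZHatModZ] [IsOrderedAddMonoid ZHatModZ]
    {G : Type*} [AddCommGroup G] [One G] {f : G →+ ZHat} (hf : Function.Injective f) (h1 : f 1 = 1)
    (hp : ∀ n : ℕ, 0 < n → ∀ x : G, (∃ b, f x = n • b) → ∃ y, x = n • y) :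
    ∃ (_ : LinearOrder G) (_ : IsOrderedAddMonoid G), IsPresburger G ∧
      ∀ x y : G, f x ≤ f y ↔ x ≤ y := by
  obtain ⟨lo, ho, hG, hle⟩ := (hasIntDivision_of_pure hf h1 hp).exists_lexOrder
    ((QuotientAddGroup.mk' (AddSubgroup.zmultiples (1 : ZHat))).comp f) fun x => by
      refine (mk_zHat_eq_zero_iff (f x)).trans (exists_congr fun k => ?_)
      rw [← h1, ← map_zsmul, hf.eq_iff]
  refine ⟨lo, ho, hG, fun x y => ?_⟩
  rw [hle]
  change LexNonneg (f y - f x) ↔ _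
  rw [← map_sub]
  refine or_congr Iff.rfl (exists_congr fun n => ?_)
  rw [← hf.eq_iff, map_nsmul, h1, nsmul_one]

/-- The embedding of `{+, ≤}`-structures given by an order embedding into `ZHat`. -/
noncomputable def ordEmbedding [LinearOrder ZHatModZ] {G : Type*} [AddCommGroup G] [LE G]
    (f : G →+ ZHat) (hf : Function.Injective f) (hle : ∀ x y : G, f x ≤ f y ↔ x ≤ y) :
    G ↪[ordLang] ZHat where
  toFun := f
  inj' := hf
  map_fun' := by
    rintro n ⟨⟩ v
    exact map_add f _ _
  map_rel' := by
    rintro n ⟨⟩ v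
    exact hle _ _

theorem leibnizian_of_equiv_range [LinearOrder ZHatModZ] [IsOrderedAddMonoid ZHatModZ]
    {G : Type*} [AddCommGroup G] [One G] {f : G →+ ZHat} (hf : Function.Injective f) (h1 : f 1 = 1)
    (hp : ∀ n : ℕ, 0 < n → ∀ x : G, (∃ b, f x = n • b) → ∃ y, x = n • y) {M : Type*}
    [ordLang.Structure M] {H : ordLang.Substructure ZHat} (hH : Set.range f = H)
    (e : M ≃[ordLang] H) : IsOrderedZGroup M ∧ IsLeibnizian ordLang M := by
  obtain ⟨_, _, hG, hle⟩ := exists_isPresburger_of_pure hf h1 hp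
  obtain rfl : (ordEmbedding f hf hle).toHom.range = H := SetLike.coe_injective hH
  have e' : M ≃[ordLang] G := (ordEmbedding f hf hle).equivRange.symm.comp e
  exact ⟨model_of_equiv _ e' hG.isOrderedZGroup,
    (hG.isLeibnizian (residuallySeparated_of_injective hf)).of_equiv e'⟩

theorem leibnizian_ordered_iff (M : Type*) [s : ordLang.Structure M] :
    (IsOrderedZGroup M ∧ IsLeibnizian ordLang M) ↔
      ∃ (_ : LinearOrder ZHatModZ) (_ : IsOrderedAddMonoid ZHatModZ)
        (H : ordLang.Substructure ZHat),
        IsZSubgroup (H : Set ZHat) ∧ Nonempty (M ≃[ordLang] H) := by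
  constructor
  · rintro ⟨hM, hL⟩
    obtain ⟨_, _, _, _, rfl, hG⟩ := exists_isPresburger_of_isOrderedZGroup hM
    obtain ⟨f, h1, hp⟩ := hG.exists_toZHat
    have hf := injective_of_residuallySeparated
      (hG.residuallySeparated ordInterpretation_models hL) hp
    obtain ⟨lo, ho, hle⟩ := hG.exists_order_zHatModZ hf h1
    exact ⟨lo, ho, (ordEmbedding f hf hle).toHom.range, isZSubgroup_range h1 hp,
      ⟨(ordEmbedding f hf hle).equivRange⟩⟩
  · rintro ⟨lo, ho, H, ⟨H', hH, h1, hp⟩, ⟨e⟩⟩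
    let _ : One H' := ⟨⟨1, h1⟩⟩
    refine leibnizian_of_equiv_range (f := H'.subtype) Subtype.val_injective rfl
      (fun n hn x hb => ?_) (Subtype.range_coe.trans hH) e
    obtain ⟨y, hy, h⟩ := hp n hn x x.2 hb
    exact ⟨⟨y, hy⟩, Subtype.ext h⟩

/-! ### Cardinalities -/

/-- The partial sum of the selected factorials `(j + 1)!` for `j < n`. -/
def factorialSum (ε : ℕ → Bool) (n : ℕ) : ℕ :=
  ∑ j ∈ Finset.range n, if ε j then (j + 1).factorial else 0

theorem factorialSum_succ (ε : ℕ → Bool) (n : ℕ) :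
    factorialSum ε (n + 1) = factorialSum ε n + if ε n then (n + 1).factorial else 0 :=
  Finset.sum_range_succ _ _

/-- With `factorialSum_modEq`, this lets the residue modulo `(k + 1)!` determine the partial sum
itself. -/
theorem factorialSum_lt (ε : ℕ → Bool) (n : ℕ) : factorialSum ε n < (n + 1).factorial := by
  induction n with
  | zero => simp [factorialSum]
  | succ n ih =>
    rw [factorialSum_succ, Nat.factorial_succ (n + 1)]
    have h : (if ε n then (n + 1).factorial else 0) ≤ (n + 1).factorial := by split <;> simp
    nlinarith [Nat.zero_le (n * (n + 1).factorial)]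

theorem factorialSum_modEq (ε : ℕ → Bool) {m k N : ℕ} (hm : m ∣ (k + 1).factorial) (h : k ≤ N) :
    factorialSum ε N ≡ factorialSum ε k [MOD m] := by
  induction N, h using Nat.le_induction with
  | base => rfl
  | succ N hN ih =>
    rw [factorialSum_succ]
    have h0 : (if ε N then (N + 1).factorial else 0) ≡ 0 [MOD m] := by
      rw [Nat.modEq_zero_iff_dvd]
      split
      · exact hm.trans (Nat.factorial_dvd_factorial (by omega))
      · exact dvd_zero m
    exact ih.add h0

/-- The series of selected factorials converges in `ZHat`, since modulo `n` its terms vanish from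
index `n` on. Its partial sums, and hence its digits, are recovered from residues modulo factorials.
-/
theorem exists_injective_toZHat : ∃ f : (ℕ → Bool) → ZHat, Function.Injective f := by
  have hex : ∀ ε : ℕ → Bool, ∃ x : ZHat, ∀ n, ZHat.res n x = (factorialSum ε n : ZMod n) := by
    intro ε
    refine ZHat.exists_of_compatible _ fun m n h => ?_
    rw [map_natCast, ZMod.natCast_eq_natCast_iff]
    refine factorialSum_modEq ε ?_ (Nat.le_of_dvd n.pos h)
    exact Nat.dvd_factorial m.pos (by omega)
  choose f hf using hex
  refine ⟨f, fun ε δ h => ?_⟩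
  have key : ∀ k, factorialSum ε k = factorialSum δ k := by
    intro k
    obtain ⟨N, hN⟩ : ∃ N : ℕ+, (N : ℕ) = (k + 1).factorial := 
      ⟨Nat.toPNat (k + 1).factorial (Nat.factorial_pos _), rfl⟩
    have h1 := congrArg (ZHat.res N) h
    rw [hf, hf, ZMod.natCast_eq_natCast_iff, hN] at h1
    have hk : k ≤ (k + 1).factorial := (Nat.le_succ k).trans (Nat.self_le_factorial _)
    have h2 := ((factorialSum_modEq ε dvd_rfl hk).symm.trans h1).trans
      (factorialSum_modEq δ dvd_rfl hk)
    exact Nat.ModEq.eq_of_lt_of_lt h2 (factorialSum_lt ε k) (factorialSum_lt δ k)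
  funext k
  have h1 := key (k + 1)
  rw [factorialSum_succ, factorialSum_succ, key k] at h1
  have := Nat.factorial_ne_zero (k + 1)
  cases hε : ε k <;> cases hδ : δ k <;> simp_all

theorem two_power_aleph0_le_mk_zHat : 2 ^ (ℵ₀ : Cardinal.{0}) ≤ #ZHat := by
  obtain ⟨f, hf⟩ := exists_injective_toZHat
  have := Cardinal.mk_le_of_injective hf
  simpa using this

/-- The pure hull of the subgroup generated by `S`. -/
def pureHull (S : Set ZHat) : AddSubgroup ZHat where
  carrier := {x | ∃ n : ℕ, 0 < n ∧ n • x ∈ AddSubgroup.closure S}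
  zero_mem' := ⟨1, one_pos, by simp⟩
  add_mem' := by
    rintro x y ⟨n, hn, hx⟩ ⟨m, hm, hy⟩
    refine ⟨n * m, Nat.mul_pos hn hm, ?_⟩
    rw [nsmul_add]
    refine add_mem ?_ ?_
    · rw [mul_nsmul]; exact nsmul_mem hx m
    · rw [mul_nsmul']; exact nsmul_mem hy n
  neg_mem' := by
    rintro x ⟨n, hn, hx⟩
    exact ⟨n, hn, by rw [smul_neg]; exact neg_mem hx⟩

theorem subset_pureHull (S : Set ZHat) : S ⊆ pureHull S := fun x hx =>
  ⟨1, one_pos, by rw [one_nsmul]; exact AddSubgroup.subset_closure hx⟩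

theorem pureHull_pure (S : Set ZHat) {n : ℕ} (hn : 0 < n) {b : ZHat} (h : n • b ∈ pureHull S) :
    b ∈ pureHull S := by
  obtain ⟨m, hm, h⟩ := h
  exact ⟨m * n, Nat.mul_pos hm hn, by rwa [mul_nsmul']⟩

theorem mk_closure_le (S : Set ZHat) : #(AddSubgroup.closure S) ≤ max #S ℵ₀ := by
  let g : (S →₀ ℤ) → ZHat := fun c => c.sum fun s k => k • (s : ZHat)
  have h : (AddSubgroup.closure S : Set ZHat) ⊆ Set.range g := by
    intro x hx
    rw [SetLike.mem_coe, ← Submodule.span_int_eq_addSubgroupClosure] at hx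
    obtain ⟨c, hc⟩ := (Finsupp.mem_span_iff_linearCombination ℤ S x).1 hx
    exact ⟨c, hc⟩
  refine (Cardinal.mk_le_mk_of_subset h).trans (Cardinal.mk_range_le.trans ?_)
  rcases isEmpty_or_nonempty S with hS | hS
  · exact (Cardinal.mk_le_aleph0).trans (le_max_right _ _)
  · rw [Cardinal.mk_finsupp_of_infinite']
    simp

/-- By torsion-freeness `x` is determined by the pair `(n, n • x)`, with `n • x` in the generated
subgroup. -/
theorem mk_pureHull_le (S : Set ZHat) : #(pureHull S) ≤ max #S ℵ₀ := by
  choose n hn hx using fun x : pureHull S => x.2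
  have hinj : Function.Injective fun x : pureHull S =>
      ((n x, ⟨n x • (x : ZHat), hx x⟩) : ℕ × AddSubgroup.closure S) := by
    intro x y hxy
    simp only [Prod.mk.injEq, Subtype.mk.injEq] at hxy
    rw [hxy.1] at hxy
    exact Subtype.ext (ZHat.hasIntDivision.nsmul_left_cancel (hn y) hxy.2)
  refine (Cardinal.mk_le_of_injective hinj).trans ?_
  rw [Cardinal.mk_prod, Cardinal.lift_uzero, Cardinal.lift_uzero, Cardinal.mk_nat]
  exact (mul_le_mul' le_rfl (mk_closure_le S)).trans
    ((Cardinal.mul_le_max_of_aleph0_le_left le_rfl).trans (by simp))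

theorem exists_not_zsmul_one : ∃ t : ZHat, ∀ k : ℤ, t ≠ k • (1 : ZHat) := by
  by_contra! h
  have h1 : #ZHat ≤ #ℤ := Cardinal.mk_le_of_surjective (f := fun k : ℤ => k • (1 : ZHat))
    fun x => by obtain ⟨k, hk⟩ := h x; exact ⟨k, hk.symm⟩
  have h2 := two_power_aleph0_le_mk_zHat.trans h1
  rw [Cardinal.mk_int] at h2
  exact absurd h2 (Cardinal.cantor _).not_ge

theorem exists_hasIntDivision_mk_eq.{w} (κ : Cardinal.{w}) (h0 : ℵ₀ ≤ κ)
    (h1 : κ ≤ 2 ^ (ℵ₀ : Cardinal.{w})) :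
    ∃ (G : Type w) (_ : AddCommGroup G) (_ : One G), #G = κ ∧ HasIntDivision G ∧
      ResiduallySeparated G ∧ ∃ t : G, ∀ k : ℤ, t ≠ k • (1 : G) := by
  -- `ZHat` lives in the lowest universe; the subgroup is built there and lifted.
  obtain ⟨κ, rfl⟩ : ∃ κ' : Cardinal.{0}, lift.{w} κ' = κ := by
    refine Cardinal.mem_range_lift_of_le (b := κ) (a := 2 ^ (ℵ₀ : Cardinal.{0})) ?_
    simpa using h1
  have h0 : ℵ₀ ≤ κ := by simpa using h0
  have h1 : κ ≤ 2 ^ (ℵ₀ : Cardinal.{0}) := by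
    rw [← Cardinal.lift_le.{w}]; simpa using h1
  obtain ⟨S, hS⟩ := Cardinal.le_mk_iff_exists_set.1 (h1.trans two_power_aleph0_le_mk_zHat)
  obtain ⟨t, ht⟩ := exists_not_zsmul_one
  -- `S` provides the cardinality, `1` the distinguished element, and `t` makes the group different
  -- from `ℤ`.
  set H := pureHull (insert 1 (insert t S)) with hH
  have hmem1 : (1 : ZHat) ∈ H := subset_pureHull _ (by simp)
  have hmemt : t ∈ H := subset_pureHull _ (by simp)
  have hcard : #H = κ := by
    refine le_antisymm ((mk_pureHull_le _).trans (max_le ?_ h0)) ?_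
    · refine Cardinal.mk_insert_le.trans ?_
      refine (add_le_add_left Cardinal.mk_insert_le 1).trans ?_
      rw [hS, add_assoc]
      exact (Cardinal.add_eq_left h0 ((by norm_num : (1 + 1 : Cardinal) < ℵ₀).le.trans h0)).le
    · rw [← hS]
      exact Cardinal.mk_le_mk_of_subset fun x hx => subset_pureHull _ (by simp [hx])
  let _ : One H := ⟨⟨1, hmem1⟩⟩
  let f : ULift.{w} H →+ ZHat := H.subtype.comp AddEquiv.ulift.toAddMonoidHom
  have hf : Function.Injective f := Subtype.val_injective.comp ULift.down_injective
  refine ⟨ULift.{w} H, inferInstance, inferInstance, by rw [Cardinal.mk_uLift, hcard],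
    hasIntDivision_of_pure (f := f) hf rfl ?_, residuallySeparated_of_injective hf,
    ⟨⟨t, hmemt⟩⟩, ?_⟩
  · rintro n hn x ⟨b, hb⟩
    have hbH : b ∈ H := pureHull_pure _ hn (by rw [← hb]; exact x.down.2)
    exact ⟨⟨⟨b, hbH⟩⟩, hf (by rw [hb, map_nsmul]; rfl)⟩
  · intro k hk
    refine ht k ?_
    have := congrArg f hk
    rw [map_zsmul] at this
    exact this

/-- If `|t|` were bounded by a multiple of `1`, discreteness would make `t` standard. -/
theorem IsPresburger.not_archimedean {G : Type*} [AddCommGroup G] [LinearOrder G]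
    [IsOrderedAddMonoid G] [One G] (hG : IsPresburger G) {t : G} (ht : ∀ k : ℤ, t ≠ k • (1 : G)) :
    ¬ Archimedean G := by
  intro hA
  obtain ⟨n, hn⟩ := hA.arch |t| hG.one_pos
  obtain ⟨k, hk⟩ := exists_nat_of_le hG.one_le n (abs_nonneg t) hn
  rcases abs_choice t with h | h
  · exact ht k (by rw [natCast_zsmul, ← hk, h])
  · exact ht (-k) (by rw [neg_zsmul, natCast_zsmul, ← hk, h, neg_neg])

/-- An isomorphism `f` preserves `1`, so `t` and `f t • 1` would have the same image. -/
theorem isEmpty_equiv_int {G : Type*} [AddCommGroup G] [One G] {t : G}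
    (ht : ∀ k : ℤ, t ≠ k • (1 : G)) : IsEmpty (G ≃[unordLang] ℤ) := by
  refine ⟨fun e => ?_⟩
  let f : G →+ ℤ := AddMonoidHom.mk' e fun a b => e.map_fun unordAdd ![a, b]
  have h1 : f 1 = 1 := e.map_fun unordOne ![]
  refine ht (f t) (e.injective ?_)
  change f t = f (f t • (1 : G))
  rw [map_zsmul, h1]
  simp

end ZGroups

theorem mainTheorem4 :
    -- Leibnizian unordered `ℤ`-groups are, up to isomorphism, the `ℤ`-subgroups of `ZHat`
    (∀ (M : Type u) [unordLang.Structure M],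
      (IsUnorderedZGroup M ∧ IsLeibnizian unordLang M) ↔
        ∃ H : unordLang.Substructure ZHat,
          IsZSubgroup (H : Set ZHat) ∧ Nonempty (M ≃[unordLang] H)) ∧
    -- Leibnizian `ℤ`-groups are, up to isomorphism, the `ℤ`-subgroups of `(ZHat, ≤)`, where `≤` is
    -- the lexicographic order induced by some group order on `ZHat / ℤ`
    (∀ (M : Type u) [ordLang.Structure M],
      (IsOrderedZGroup M ∧ IsLeibnizian ordLang M) ↔
        ∃ (_ : LinearOrder ZHatModZ) (_ : IsOrderedAddMonoid ZHatModZ)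
          (H : ordLang.Substructure ZHat),
          IsZSubgroup (H : Set ZHat) ∧ Nonempty (M ≃[ordLang] H)) ∧
    -- existence in all cardinalities between `ℵ₀` and `2 ^ ℵ₀`
    (∀ κ : Cardinal.{u}, ℵ₀ ≤ κ → κ ≤ 2 ^ (ℵ₀ : Cardinal.{u}) →
      (∃ (G : Type u) (_ : AddCommGroup G) (_ : LinearOrder G) (_ : IsOrderedAddMonoid G),
        #G = κ ∧ IsOrderedZGroup G ∧ IsLeibnizian ordLang G ∧ ¬ Archimedean G) ∧
      (∃ (G : Type u) (_ : AddCommGroup G) (_ : One G),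
        #G = κ ∧ IsUnorderedZGroup G ∧ IsLeibnizian unordLang G ∧
          IsEmpty (G ≃[unordLang] ℤ))) := by
  refine ⟨fun M _ => leibnizian_unordered_iff M, fun M _ => leibnizian_ordered_iff M,
    fun κ h0 h1 => ?_⟩
  obtain ⟨G, _, _, hκ, hG, hs, t, ht⟩ := exists_hasIntDivision_mk_eq κ h0 h1
  refine ⟨?_, G, inferInstance, inferInstance, hκ, hG.isUnorderedZGroup, hG.isLeibnizian hs,
    isEmpty_equiv_int ht⟩
  obtain ⟨lo, ho, hG'⟩ := hG.exists_isPresburger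
  exact ⟨G, inferInstance, lo, ho, hκ, hG'.isOrderedZGroup, hG'.isLeibnizian hs,
    hG'.not_archimedean ht⟩
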